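/- Let $d\ge 1$ be an integer and $\alpha\in(0,1)$. Let $\Phi(\theta)=\sum_{i=1}^d 4\sin^2(\theta_i/2)$ for $\theta\in[-\pi,\pi]^d$, and for $u\in\ell^2(\mathbb Z^d)$ (real-valued) let $\hat u(\theta)=\sum_{x\in\mathbb Z^d}u(x)e^{ix\cdot\theta}$, the series converging in $L^2([-\pi,\pi]^d)$. The discrete fractional Laplacian of $u\in\ell^2(\mathbb Z^d)$ is $$(-\Delta)^\alpha u(x)=\frac1{(2\pi)^d}\int_{[-\pi,\pi]^d}\Phi(\theta)^\alpha\,\hat u(\theta)\,e^{-ix\cdot\theta}\,d\theta ,\qquad x\in\mathbb Z^d.$$ Let $h:\mathbb Z^d\to\mathbb R$ and $f:\mathbb Z^d\times\mathbb R\to\mathbb R$, put $F(x,u)=\int_0^u f(x,t)\,dt$, and assume: ($h_1$) there are constants $c_1,c_2>0$ with $c_1\le h(x)\le c_2$ for all $x\in\mathbb Z^d$; ($f_1$) $f(x,\cdot)$ is continuous on $\mathbb R$ for every $x$; ($f_2$) there are $a>0$ and $p>2$ with $|f(x,u)|\le a(1+|u|^{p-1})$ for all $x,u$; ($f_3$)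 $f(x,u)=o(u)$ as $|u|\to0$, uniformly in $x$; ($f_4$) for every $x$, $u\mapsto f(x,u)/|u|$ is strictly increasing on $(-\infty,0)$ and on $(0,+\infty)$; ($f_5$) $F(x,u)/u^2\to+\infty$ as $|u|\to+\infty$, uniformly in $x$; ($f_6$) $h$ and $f$ are $1$-periodic in each coordinate $x_i$, $1\le i\le d$. Let $H^\alpha$ be the space of all $u\in\ell^2(\mathbb Z^d)$ for which $$\|u\|_\alpha^2=\frac1{(2\pi)^d}\int_{[-\pi,\pi]^d}\Phi(\theta)^\alpha|\hat u(\theta)|^2\,d\theta+\sum_{x\in\mathbb Z^d}h(x)u(x)^2$$ is finite, with the norm $\|\cdot\|_\alpha$, and let $$I(u)=\tfrac12\|u\|_\alpha^2-\sum_{x\in\mathbb Z^d}F(x,u(x)),\qquad \mathcal M=\{u\in H^\alpha\setminus\{0\}:\langle I'(u),u\rangle=0\}.$$ Then the equation $$(-\Delta)^\alpha u+h(x)u=f(x,u),\qquad x\in\mathbb Z^d,$$ has a ground state solution: there is $u\in H^\alpha$, $u\neq0$, with $I'(u)=0$ and $I(u)=\inf_{\mathcal M}I>0$, and this $u$ satisfies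 the equation at every $x\in\mathbb Z^d$. -/

import Mathlib

open MeasureTheory

noncomputable section

namespace FracSchrodinger

/-! ### The discrete Fourier transform -/

/-- The real sequence space `ℓ²(ℤᵈ)`. -/
abbrev EllTwo (d : ℕ) : Type := lp (fun _ : Fin d → ℤ => ℝ) 2

/-- Lebesgue measure on the cube `[-π, π]ᵈ`. -/
def cubeMeasure (d : ℕ) : Measure (Fin d → ℝ) :=
  volume.restrict (Set.univ.pi fun _ : Fin d => Set.Icc (-Real.pi) Real.pi)

instance (d : ℕ) : IsFiniteMeasure (cubeMeasure d) :=
  ⟨by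
    rw [cubeMeasure, Measure.restrict_apply_univ]
    exact (isCompact_univ_pi fun _ => isCompact_Icc).measure_lt_top⟩

/-- The function `θ ↦ e^{i x·θ}`. -/
def character {d : ℕ} (x : Fin d → ℤ) (θ : Fin d → ℝ) : ℂ :=
  Complex.exp (Complex.I * ∑ i, (x i : ℂ) * (θ i : ℂ))

theorem norm_character {d : ℕ} (x : Fin d → ℤ) (θ : Fin d → ℝ) : ‖character x θ‖ = 1 := by
  have h : Complex.I * ∑ i, (x i : ℂ) * (θ i : ℂ)
      = ((∑ i, (x i : ℝ) * θ i : ℝ) : ℂ) * Complex.I := by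
    push_cast; ring
  rw [character, h, Complex.norm_exp_ofReal_mul_I]

theorem continuous_character {d : ℕ} (x : Fin d → ℤ) : Continuous (character x) := by
  unfold character
  fun_prop

theorem memLp_character {d : ℕ} (x : Fin d → ℤ) : MemLp (character x) 2 (cubeMeasure d) :=
  MemLp.of_bound (continuous_character x).aestronglyMeasurable 1
    (Filter.Eventually.of_forall fun θ => (norm_character x θ).le)

/-- The function `θ ↦ e^{i x·θ}` as an element of `L²([-π, π]ᵈ; ℂ)`. -/
def characterLp {d : ℕ} (x : Fin d → ℤ) : Lp ℂ 2 (cubeMeasure d) :=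
  (memLp_character x).toLp (character x)

/-- The discrete Fourier transform `û = ∑ₓ u(x) e^{i x·θ}` of `u ∈ ℓ²(ℤᵈ)`; the series is
summed in `L²([-π, π]ᵈ; ℂ)`, where it converges by `hasSum_fourierTransform` below. -/
def fourierTransform {d : ℕ} (u : EllTwo d) : Lp ℂ 2 (cubeMeasure d) :=
  ∑' x, (u x : ℂ) • characterLp x

theorem integral_exp_int (n : ℤ) :
    ∫ t in Set.Icc (-Real.pi) Real.pi, Complex.exp (Complex.I * ((n : ℂ) * (t : ℂ)))
      = if n = 0 then ((2 * Real.pi : ℝ) : ℂ) else 0 := by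
  rw [integral_Icc_eq_integral_Ioc,
    ← intervalIntegral.integral_of_le (by linarith [Real.pi_pos])]
  split_ifs with hn
  · subst hn
    simp
    ring
  · have hc : Complex.I * (n : ℂ) ≠ 0 :=
      mul_ne_zero Complex.I_ne_zero (by exact_mod_cast hn)
    simp_rw [← mul_assoc]
    rw [integral_exp_mul_complex hc, div_eq_zero_iff]
    left
    rw [sub_eq_zero, Complex.exp_eq_exp_iff_exists_int]
    exact ⟨n, by push_cast; ring⟩

theorem inner_characterLp {d : ℕ} (x y : Fin d → ℤ) :
    inner ℂ (characterLp x) (characterLp y)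
      = if x = y then (((2 * Real.pi) ^ d : ℝ) : ℂ) else 0 := by
  have h1 : inner ℂ (characterLp x) (characterLp y)
      = ∫ θ, ∏ i, Complex.exp (Complex.I * (((y i - x i : ℤ) : ℂ) * (θ i : ℂ)))
          ∂(cubeMeasure d) := by
    rw [L2.inner_def]
    refine integral_congr_ae ?_
    filter_upwards [(memLp_character x).coeFn_toLp, (memLp_character y).coeFn_toLp] with θ hx hy
    simp only [characterLp, hx, hy, RCLike.inner_apply, character]
    rw [← Complex.exp_conj, ← Complex.exp_add, ← Complex.exp_sum]
    congr 1
    simp only [map_mul, map_sum, Complex.conj_I, Complex.conj_ofReal, Finset.mul_sum,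
      map_intCast, ← Finset.sum_add_distrib]
    refine Finset.sum_congr rfl fun i _ => ?_
    push_cast
    ring
  have h2 : cubeMeasure d = Measure.pi fun _ : Fin d =>
      (volume : Measure ℝ).restrict (Set.Icc (-Real.pi) Real.pi) := by
    rw [cubeMeasure, volume_pi, Measure.restrict_pi_pi]
  rw [h1, h2, integral_fintype_prod_eq_prod (𝕜 := ℂ) (fun (i : Fin d) (t : ℝ) =>
    Complex.exp (Complex.I * (((y i - x i : ℤ) : ℂ) * (t : ℂ))))]
  simp_rw [integral_exp_int]
  split_ifs with hxy
  · subst hxy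
    simp
  · obtain ⟨i, hi⟩ := Function.ne_iff.mp hxy
    refine Finset.prod_eq_zero (Finset.mem_univ i) (if_neg ?_)
    exact fun h => hi (sub_eq_zero.mp h).symm

theorem orthonormal_characterLp (d : ℕ) :
    Orthonormal ℂ fun x : Fin d → ℤ =>
      (((Real.sqrt ((2 * Real.pi) ^ d))⁻¹ : ℝ) : ℂ) • characterLp x := by
  rw [orthonormal_iff_ite]
  intro x y
  have hpos : 0 < (2 * Real.pi) ^ d := by positivity
  rw [inner_smul_left, inner_smul_right, inner_characterLp, Complex.conj_ofReal]
  split_ifs with hxy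
  · rw [← Complex.ofReal_mul, ← Complex.ofReal_mul, ← Complex.ofReal_one]
    congr 1
    have hs := Real.mul_self_sqrt hpos.le
    have hs0 : Real.sqrt ((2 * Real.pi) ^ d) ≠ 0 := (Real.sqrt_pos.mpr hpos).ne'
    field_simp
    nlinarith
  · simp

theorem summable_sq {d : ℕ} (u : EllTwo d) : Summable fun x => u x ^ 2 := by
  have h := (memℓp_gen_iff (by norm_num)).mp (lp.memℓp u)
  simpa using h

theorem hasSum_fourierTransform {d : ℕ} (u : EllTwo d) :
    HasSum (fun x => (u x : ℂ) • characterLp x) (fourierTransform u) := by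
  have hpos : 0 < (2 * Real.pi) ^ d := by positivity
  have hs0 : ((Real.sqrt ((2 * Real.pi) ^ d) : ℝ) : ℂ) ≠ 0 := by
    exact_mod_cast (Real.sqrt_pos.mpr hpos).ne'
  have h := ((orthonormal_characterLp d).orthogonalFamily.summable_iff_norm_sq_summable
    fun x => (u x : ℂ)).mpr (by simpa using summable_sq u)
  have h' := h.const_smul ((Real.sqrt ((2 * Real.pi) ^ d) : ℝ) : ℂ)
  refine Summable.hasSum (h'.congr fun x => ?_)
  simp only [LinearIsometry.toSpanSingleton_apply, smul_smul]
  congr 1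
  push_cast
  field_simp

theorem fourierTransform_add {d : ℕ} (u v : EllTwo d) :
    fourierTransform (u + v) = fourierTransform u + fourierTransform v := by
  refine (hasSum_fourierTransform (u + v)).unique ?_
  convert (hasSum_fourierTransform u).add (hasSum_fourierTransform v) using 2 with x
  simp [add_smul]

theorem fourierTransform_smul {d : ℕ} (c : ℝ) (u : EllTwo d) :
    fourierTransform (c • u) = (c : ℂ) • fourierTransform u := by
  refine (hasSum_fourierTransform (c • u)).unique ?_
  convert (hasSum_fourierTransform u).const_smul (c : ℂ) using 2 with x
  simp [mul_smul]

theorem fourierTransform_zero {d : ℕ} : fourierTransform (0 : EllTwo d) = 0 := by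
  simpa using fourierTransform_smul (0 : ℝ) (0 : EllTwo d)

/-- The inverse discrete Fourier transform. -/
def inverseFourierTransform {d : ℕ} (v : (Fin d → ℝ) → ℂ) (x : Fin d → ℤ) : ℂ :=
  (((2 * Real.pi) ^ d)⁻¹ : ℝ) *
    ∫ θ, v θ * Complex.exp (-(Complex.I * ∑ i, (x i : ℂ) * (θ i : ℂ))) ∂(cubeMeasure d)

/-! ### The fractional Laplacian -/

/-- The symbol `Φ(θ) = ∑ᵢ 4 sin²(θᵢ/2)` of `-Δ`. -/
def symbol {d : ℕ} (θ : Fin d → ℝ) : ℝ := ∑ i, 4 * Real.sin (θ i / 2) ^ 2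

theorem symbol_nonneg {d : ℕ} (θ : Fin d → ℝ) : 0 ≤ symbol θ :=
  Finset.sum_nonneg fun _ _ => by positivity

theorem measurable_symbol_rpow {d : ℕ} (α : ℝ) :
    Measurable fun θ : Fin d → ℝ => symbol θ ^ α := by
  unfold symbol
  fun_prop

/-- The discrete fractional Laplacian `(-Δ)^α u`: the function whose Fourier transform is
`Φ^α û`. Its values are real for real `u`; they are kept in `ℂ` so that no part of the
Fourier integral is discarded. -/
def fracLaplacian {d : ℕ} (α : ℝ) (u : EllTwo d) : (Fin d → ℤ) → ℂ :=
  inverseFourierTransform fun θ => ((symbol θ ^ α : ℝ) : ℂ) * fourierTransform u θ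

/-! ### The Hilbert space `H^α` -/

/-- `h` is bounded between two positive constants. -/
def BoundedPositive {d : ℕ} (h : (Fin d → ℤ) → ℝ) : Prop :=
  ∃ c₁ c₂ : ℝ, 0 < c₁ ∧ 0 < c₂ ∧ ∀ x, c₁ ≤ h x ∧ h x ≤ c₂

theorem BoundedPositive.pos {d : ℕ} {h : (Fin d → ℤ) → ℝ} (hh : BoundedPositive h)
    (x : Fin d → ℤ) : 0 < h x := by
  obtain ⟨c₁, c₂, h1, _, h2⟩ := hh
  exact h1.trans_le (h2 x).1

theorem integrable_cross {d : ℕ} {α : ℝ} {p q : Lp ℂ 2 (cubeMeasure d)}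
    (hp : Integrable (fun θ => symbol θ ^ α * ‖p θ‖ ^ 2) (cubeMeasure d))
    (hq : Integrable (fun θ => symbol θ ^ α * ‖q θ‖ ^ 2) (cubeMeasure d)) :
    Integrable (fun θ => ((symbol θ ^ α : ℝ) : ℂ) * p θ * starRingEnd ℂ (q θ))
      (cubeMeasure d) := by
  refine (hp.add hq).mono' ?_ (Filter.Eventually.of_forall fun θ => ?_)
  · have h1 := (Lp.aestronglyMeasurable p)
    have h2 := (Complex.continuous_conj.comp_aestronglyMeasurable (Lp.aestronglyMeasurable q))
    have h3 := (Complex.continuous_ofReal.measurable.comp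
      (measurable_symbol_rpow (d := d) α)).aestronglyMeasurable (μ := cubeMeasure d)
    exact (h3.mul h1).mul h2
  · have hΦ : 0 ≤ symbol θ ^ α := Real.rpow_nonneg (symbol_nonneg θ) α
    simp only [norm_mul, Complex.norm_real, Real.norm_of_nonneg hΦ, RCLike.norm_conj,
      Pi.add_apply]
    nlinarith [mul_nonneg hΦ (sq_nonneg (‖p θ‖ - ‖q θ‖)), mul_nonneg hΦ (sq_nonneg ‖p θ‖),
      mul_nonneg hΦ (sq_nonneg ‖q θ‖)]

theorem summable_cross {d : ℕ} {h : (Fin d → ℤ) → ℝ} {u v : EllTwo d}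
    (hu : Summable fun x => h x * u x ^ 2) (hv : Summable fun x => h x * v x ^ 2) :
    Summable fun x => h x * u x * v x := by
  refine Summable.of_norm_bounded (hu.abs.add hv.abs) fun x => ?_
  simp only [Real.norm_eq_abs, abs_mul, abs_pow]
  nlinarith [mul_nonneg (abs_nonneg (h x)) (sq_nonneg (|u x| - |v x|)),
    mul_nonneg (abs_nonneg (h x)) (sq_nonneg |u x|),
    mul_nonneg (abs_nonneg (h x)) (sq_nonneg |v x|)]

/-- The linear space of all `u ∈ ℓ²(ℤᵈ)` such that `∫ Φ^α |û|²` and `∑ h u²` are finite. -/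
def hSubmodule {d : ℕ} (α : ℝ) (h : (Fin d → ℤ) → ℝ) : Submodule ℝ (EllTwo d) where
  carrier := {u | Integrable (fun θ => symbol θ ^ α * ‖fourierTransform u θ‖ ^ 2)
      (cubeMeasure d) ∧ Summable fun x => h x * u x ^ 2}
  zero_mem' := by
    refine ⟨?_, by simp⟩
    rw [fourierTransform_zero]
    refine (integrable_zero _ ℝ _).congr ?_
    filter_upwards [Lp.coeFn_zero ℂ 2 (cubeMeasure d)] with θ hθ
    rw [hθ]
    simp
  add_mem' := by
    rintro u v ⟨hu1, hu2⟩ ⟨hv1, hv2⟩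
    constructor
    · rw [fourierTransform_add]
      have hc := (integrable_cross hu1 hv1).re.const_mul 2
      refine ((hu1.add hv1).add hc).congr ?_
      filter_upwards [Lp.coeFn_add (fourierTransform u) (fourierTransform v)] with θ hθ
      simp only [hθ, Pi.add_apply, ← Complex.normSq_eq_norm_sq, Complex.normSq_add, mul_assoc,
        RCLike.re_to_complex, Complex.re_ofReal_mul]
      ring
    · refine ((hu2.add hv2).add ((summable_cross hu2 hv2).mul_left 2)).congr fun x => ?_
      simp only [lp.coeFn_add, Pi.add_apply]
      ring
  smul_mem' := by
    rintro c u ⟨hu1, hu2⟩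
    constructor
    · rw [fourierTransform_smul]
      refine (hu1.const_mul (c ^ 2)).congr ?_
      filter_upwards [Lp.coeFn_smul (c : ℂ) (fourierTransform u)] with θ hθ
      simp only [hθ, Pi.smul_apply, smul_eq_mul, norm_mul, Complex.norm_real, mul_pow,
        Real.norm_eq_abs, sq_abs]
      ring
    · refine (hu2.mul_left (c ^ 2)).congr fun x => ?_
      simp only [lp.coeFn_smul, Pi.smul_apply, smul_eq_mul]
      ring

/-- The space `H^α`, to be normed by `‖u‖² = (2π)⁻ᵈ ∫ Φ^α |û|² + ∑ h u²`. It is a separate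
type so that it does not inherit the norm of `ℓ²(ℤᵈ)`; the positivity of `h`, carried as a
parameter, makes the form below definite. -/
def HSpace {d : ℕ} (α : ℝ) {h : (Fin d → ℤ) → ℝ} (_hh : BoundedPositive h) : Type :=
  hSubmodule α h

namespace HSpace

variable {d : ℕ} {α : ℝ} {h : (Fin d → ℤ) → ℝ} {hh : BoundedPositive h}

instance : AddCommGroup (HSpace α hh) := inferInstanceAs (AddCommGroup (hSubmodule α h))

instance : Module ℝ (HSpace α hh) := inferInstanceAs (Module ℝ (hSubmodule α h))

/-- The inclusion of `H^α` in `ℓ²(ℤᵈ)`. -/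
def toEllTwo : HSpace α hh →ₗ[ℝ] EllTwo d := (hSubmodule α h).subtype

instance : CoeFun (HSpace α hh) fun _ => (Fin d → ℤ) → ℝ := ⟨fun u => toEllTwo u⟩

theorem integrable_sq (u : HSpace α hh) :
    Integrable (fun θ => symbol θ ^ α * ‖fourierTransform (toEllTwo u) θ‖ ^ 2)
      (cubeMeasure d) := (show hSubmodule α h from u).2.1

theorem summable_mul_sq (u : HSpace α hh) : Summable fun x => h x * u x ^ 2 :=
  (show hSubmodule α h from u).2.2

/-- The inner product of `H^α`. For real `u` and `v` the integral is real. -/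
def form (u v : HSpace α hh) : ℝ :=
  ((2 * Real.pi) ^ d)⁻¹ *
      (∫ θ, ((symbol θ ^ α : ℝ) : ℂ) * fourierTransform (toEllTwo u) θ *
        starRingEnd ℂ (fourierTransform (toEllTwo v) θ) ∂(cubeMeasure d)).re +
    ∑' x, h x * u x * v x

theorem form_self (u : HSpace α hh) :
    form u u = ((2 * Real.pi) ^ d)⁻¹ *
        ∫ θ, symbol θ ^ α * ‖fourierTransform (toEllTwo u) θ‖ ^ 2 ∂(cubeMeasure d) +
      ∑' x, h x * u x ^ 2 := by
  unfold form
  congr 1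
  · congr 1
    rw [← Complex.ofReal_re (∫ θ, symbol θ ^ α * ‖fourierTransform (toEllTwo u) θ‖ ^ 2
      ∂(cubeMeasure d)), ← integral_complex_ofReal]
    congr 2
    funext θ
    rw [mul_assoc, Complex.mul_conj, Complex.normSq_eq_norm_sq]
    push_cast
    rfl
  · exact tsum_congr fun x => by ring

/-- The form `form` is a real inner product. -/
abbrev innerCore : InnerProductSpace.Core ℝ (HSpace α hh) where
  inner := form
  conj_inner_symm u v := by
    simp only [form, conj_trivial]
    congr 1
    · congr 1
      rw [← Complex.conj_re, ← integral_conj]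
      congr 2
      funext θ
      simp only [map_mul, Complex.conj_conj, Complex.conj_ofReal]
      ring
    · exact tsum_congr fun x => by ring
  re_inner_nonneg u := by
    change 0 ≤ form u u
    rw [form_self]
    refine add_nonneg (mul_nonneg (by positivity) (integral_nonneg fun θ => ?_))
      (tsum_nonneg fun x => mul_nonneg (hh.pos x).le (sq_nonneg _))
    exact mul_nonneg (Real.rpow_nonneg (symbol_nonneg θ) α) (sq_nonneg _)
  add_left u v w := by
    have h1 : ∫ θ, ((symbol θ ^ α : ℝ) : ℂ) * fourierTransform (toEllTwo (u + v)) θ *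
          starRingEnd ℂ (fourierTransform (toEllTwo w) θ) ∂(cubeMeasure d)
        = (∫ θ, ((symbol θ ^ α : ℝ) : ℂ) * fourierTransform (toEllTwo u) θ *
            starRingEnd ℂ (fourierTransform (toEllTwo w) θ) ∂(cubeMeasure d))
          + ∫ θ, ((symbol θ ^ α : ℝ) : ℂ) * fourierTransform (toEllTwo v) θ *
            starRingEnd ℂ (fourierTransform (toEllTwo w) θ) ∂(cubeMeasure d) := by
      rw [← integral_add (integrable_cross u.integrable_sq w.integrable_sq)
        (integrable_cross v.integrable_sq w.integrable_sq), map_add, fourierTransform_add]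
      refine integral_congr_ae ?_
      filter_upwards [Lp.coeFn_add (fourierTransform (toEllTwo u))
        (fourierTransform (toEllTwo v))] with θ hθ
      rw [hθ, Pi.add_apply]
      ring
    have h2 : ∑' x, h x * (u + v) x * w x
        = (∑' x, h x * u x * w x) + ∑' x, h x * v x * w x := by
      rw [← (summable_cross u.summable_mul_sq w.summable_mul_sq).tsum_add
        (summable_cross v.summable_mul_sq w.summable_mul_sq)]
      refine tsum_congr fun x => ?_
      simp only [map_add, lp.coeFn_add, Pi.add_apply]
      ring
    change form (u + v) w = form u w + form v w
    simp only [form]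
    rw [h1, h2, Complex.add_re]
    ring
  smul_left u v c := by
    have h1 : ∫ θ, ((symbol θ ^ α : ℝ) : ℂ) * fourierTransform (toEllTwo (c • u)) θ *
          starRingEnd ℂ (fourierTransform (toEllTwo v) θ) ∂(cubeMeasure d)
        = (c : ℂ) * ∫ θ, ((symbol θ ^ α : ℝ) : ℂ) * fourierTransform (toEllTwo u) θ *
            starRingEnd ℂ (fourierTransform (toEllTwo v) θ) ∂(cubeMeasure d) := by
      rw [← integral_const_mul, map_smul, fourierTransform_smul]
      refine integral_congr_ae ?_
      filter_upwards [Lp.coeFn_smul (c : ℂ) (fourierTransform (toEllTwo u))] with θ hθ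
      rw [hθ, Pi.smul_apply, smul_eq_mul]
      ring
    have h2 : ∑' x, h x * (c • u) x * v x = c * ∑' x, h x * u x * v x := by
      rw [← tsum_mul_left]
      refine tsum_congr fun x => ?_
      simp only [map_smul, lp.coeFn_smul, Pi.smul_apply, smul_eq_mul]
      ring
    change form (c • u) v = c * form u v
    simp only [form]
    rw [h1, h2, Complex.re_ofReal_mul]
    ring
  definite u hu := by
    change form u u = 0 at hu
    rw [form_self] at hu
    have h1 : 0 ≤ ((2 * Real.pi) ^ d)⁻¹ *
        ∫ θ, symbol θ ^ α * ‖fourierTransform (toEllTwo u) θ‖ ^ 2 ∂(cubeMeasure d) :=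
      mul_nonneg (by positivity) (integral_nonneg fun θ =>
        mul_nonneg (Real.rpow_nonneg (symbol_nonneg θ) α) (sq_nonneg _))
    have h2 : ∀ x, 0 ≤ h x * u x ^ 2 := fun x => mul_nonneg (hh.pos x).le (sq_nonneg _)
    have h3 : ∑' x, h x * u x ^ 2 = 0 := by 
      have h2' : 0 ≤ ∑' x, h x * u x ^ 2 := tsum_nonneg h2
      linarith
    have h4 := (hasSum_zero_iff_of_nonneg h2).mp (h3 ▸ u.summable_mul_sq.hasSum)
    refine Subtype.ext (lp.ext (funext fun x => ?_))
    have h5 : h x * u x ^ 2 = 0 := congrFun h4 x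
    exact pow_eq_zero_iff (two_ne_zero) |>.mp
      ((mul_eq_zero.mp h5).resolve_left (hh.pos x).ne')

instance : NormedAddCommGroup (HSpace α hh) :=
  InnerProductSpace.Core.toNormedAddCommGroup (𝕜 := ℝ) (cd := innerCore)

instance : InnerProductSpace ℝ (HSpace α hh) :=
  InnerProductSpace.ofCore innerCore.toCore

theorem norm_sq_eq (u : HSpace α hh) :
    ‖u‖ ^ 2 = ((2 * Real.pi) ^ d)⁻¹ *
        ∫ θ, symbol θ ^ α * ‖fourierTransform (toEllTwo u) θ‖ ^ 2 ∂(cubeMeasure d) +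
      ∑' x, h x * u x ^ 2 := by
  rw [← form_self, ← real_inner_self_eq_norm_sq]
  rfl

end HSpace

/-! ### Energy, Nehari manifold and ground states -/

/-- The primitive `F(x, u) = ∫₀ᵘ f(x, t) dt`. -/
def primitive {d : ℕ} (f : (Fin d → ℤ) → ℝ → ℝ) (x : Fin d → ℤ) (u : ℝ) : ℝ :=
  ∫ t in (0 : ℝ)..u, f x t

variable {d : ℕ} {α : ℝ} {h : (Fin d → ℤ) → ℝ} {hh : BoundedPositive h}

/-- The energy functional `I(u) = ‖u‖² / 2 - ∑ₓ F(x, u(x))` on `H^α`. -/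
def energy (f : (Fin d → ℤ) → ℝ → ℝ) (u : HSpace α hh) : ℝ :=
  1 / 2 * ‖u‖ ^ 2 - ∑' x, primitive f x (u x)

/-- The Nehari manifold `{u ∈ H^α \ {0} : ⟨I'(u), u⟩ = 0}`. -/
def nehari (α : ℝ) (hh : BoundedPositive h) (f : (Fin d → ℤ) → ℝ → ℝ) : Set (HSpace α hh) :=
  {u | u ≠ 0 ∧ fderiv ℝ (energy f) u u = 0}

/-- `u` is a ground state: a nontrivial critical point of `I` with `I(u) = inf I > 0`, the
infimum being taken over the Nehari manifold. -/
def IsGroundState (f : (Fin d → ℤ) → ℝ → ℝ) (u : HSpace α hh) : Prop :=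
  u ≠ 0 ∧ HasFDerivAt (energy f) (0 : HSpace α hh →L[ℝ] ℝ) u ∧
    IsGLB (energy f '' nehari α hh f) (energy f u) ∧ 0 < energy f u

/-- `u` solves `(-Δ)^α u + h u = f(x, u)` at every point of `ℤᵈ`. -/
def IsSolution (α : ℝ) (h : (Fin d → ℤ) → ℝ) (f : (Fin d → ℤ) → ℝ → ℝ) (u : EllTwo d) : Prop :=
  ∀ x, fracLaplacian α u x + (h x : ℂ) * (u x : ℂ) = (f x (u x) : ℂ)

end FracSchrodinger

end

/-
Periodicity under the unit lattice makes `h` constant and `f` independent of the site, and since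
the symbol `Φ^α` is bounded, `H^α` is `ℓ²(ℤᵈ)` with an equivalent translation-invariant norm. As
`ℓ² ⊆ ℓ^∞` and `g(u) = o(u)`, the superposition operator of `g` acts on `ℓ²` and the energy is `C¹`.

By the monotonicity of `g(u) / |u|` each ray meets the Nehari manifold at most once, and on it the
energy equals the excess `∑ (g(u) u / 2 - G(u))`, which is nonnegative and increases along rays.
A minimizing sequence is bounded and does not vanish in `ℓ^∞`, so after translations it has a
nonzero coordinatewise limit. The Nehari form and the excess split along the sequence as in the
Brezis–Lieb lemma; were the Nehari form of the limit positive, that of the remainder would be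
eventually negative, and the remainder alone would use up the whole infimum of the excess. Hence
the limit, scaled back to the Nehari manifold, is a minimizer.

Since `g` is only continuous, the Nehari manifold need not be `C¹`. A minimizer is nevertheless
critical: if the energy decreased in some direction, perturbing in that direction and moving along
the ray back to the manifold would lower it. Testing the vanishing derivative with the unit
sequence at `x` gives the equation at `x`.
-/

noncomputable section

namespace FracSchrodinger

open Filter Topology Asymptotics
open scoped lp ENNReal

/-! ### Scalar functions vanishing to a given order at the origin -/

/-- `φ` is continuous and `φ u = o(u ^ k)` as `u → 0`: the local condition that the nonlinearity
satisfies with `k = 1`, its primitive and its excess density with `k = 2`. -/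
structure VanishesToOrder (k : ℕ) (φ : ℝ → ℝ) : Prop where
  continuous : Continuous φ
  isLittleO : φ =o[𝓝 0] fun u => u ^ k

namespace VanishesToOrder

variable {k : ℕ} {φ ψ : ℝ → ℝ}

theorem exists_abs_le (hφ : VanishesToOrder k φ) {ε : ℝ} (hε : 0 < ε) :
    ∃ δ > 0, ∀ u, |u| < δ → |φ u| ≤ ε * |u| ^ k := by
  obtain ⟨δ, hδ, h⟩ := Metric.eventually_nhds_iff.mp (hφ.isLittleO.def hε)
  refine ⟨δ, hδ, fun u hu => ?_⟩
  simpa using h (y := u) (by simpa using hu)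

theorem apply_zero (hφ : VanishesToOrder k φ) (hk : k ≠ 0) : φ 0 = 0 := by
  obtain ⟨δ, hδ, h⟩ := hφ.exists_abs_le one_pos
  simpa [hk] using h 0 (by simpa using hδ)

theorem sub (hφ : VanishesToOrder k φ) (hψ : VanishesToOrder k ψ) :
    VanishesToOrder k fun u => φ u - ψ u :=
  ⟨hφ.continuous.sub hψ.continuous, hφ.isLittleO.sub hψ.isLittleO⟩

theorem const_mul (hφ : VanishesToOrder k φ) (c : ℝ) : VanishesToOrder k fun u => c * φ u :=
  ⟨continuous_const.mul hφ.continuous, hφ.isLittleO.const_mul_left c⟩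

theorem mul_id (hφ : VanishesToOrder k φ) : VanishesToOrder (k + 1) fun u => φ u * u := by
  refine ⟨hφ.continuous.mul continuous_id, ?_⟩
  simpa only [pow_succ] using hφ.isLittleO.mul_isBigO (isBigO_refl (fun u : ℝ => u) (𝓝 0))

theorem primitive (hφ : VanishesToOrder k φ) :
    VanishesToOrder (k + 1) fun u => ∫ t in (0 : ℝ)..u, φ t := by
  refine ⟨intervalIntegral.continuous_primitive
    (fun a b => hφ.continuous.intervalIntegrable a b) 0, IsLittleO.of_bound fun ε hε => ?_⟩
  obtain ⟨δ, hδ, h⟩ := hφ.exists_abs_le hε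
  filter_upwards [Metric.ball_mem_nhds (0 : ℝ) hδ] with u hu
  rw [mem_ball_zero_iff, Real.norm_eq_abs] at hu
  have hbound : ∀ t ∈ Set.uIoc 0 u, ‖φ t‖ ≤ ε * |u| ^ k := fun t ht => by
    have htu : |t| ≤ |u| := by
      simpa using Set.abs_sub_left_of_mem_uIcc (Set.uIoc_subset_uIcc ht)
    exact (h t (htu.trans_lt hu)).trans (by gcongr)
  simpa [pow_succ, mul_assoc] using intervalIntegral.norm_integral_le_of_norm_le_const hbound

end VanishesToOrder

theorem exists_abs_add_sub_le_of_continuous {φ : ℝ → ℝ} (hφ : Continuous φ) (k : ℕ) (B : ℝ)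
    {ε : ℝ} (hε : 0 < ε) :
    ∃ K ≥ 0, ∀ a b : ℝ, |a| ≤ B → |b| ≤ B → |φ (a + b) - φ a| ≤ ε + K * |b| ^ k := by
  have hcpt : IsCompact (Metric.closedBall (0 : ℝ) (B + B)) := isCompact_closedBall _ _
  obtain ⟨η, hη, huc⟩ := Metric.uniformContinuousOn_iff.mp
    (hcpt.uniformContinuousOn_of_continuous hφ.continuousOn) ε hε
  obtain ⟨M, hM⟩ := hcpt.exists_bound_of_continuousOn hφ.continuousOn
  refine ⟨2 * |M| / η ^ k, by positivity, fun a b ha hb => ?_⟩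
  have hamem : a ∈ Metric.closedBall (0 : ℝ) (B + B) := by
    rw [mem_closedBall_zero_iff, Real.norm_eq_abs]
    linarith [abs_nonneg b]
  have habmem : a + b ∈ Metric.closedBall (0 : ℝ) (B + B) := by
    rw [mem_closedBall_zero_iff, Real.norm_eq_abs]
    linarith [abs_add_le a b]
  rcases lt_or_ge |b| η with hbη | hbη
  · have hclose := huc (a + b) habmem a hamem (by simpa using hbη)
    have : 0 ≤ 2 * |M| / η ^ k * |b| ^ k := by positivity
    rw [Real.dist_eq] at hclose
    linarith
  · have hfar : 2 * |M| ≤ 2 * |M| / η ^ k * |b| ^ k := by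
      rw [div_mul_eq_mul_div, le_div_iff₀ (by positivity)]
      gcongr
    calc |φ (a + b) - φ a| ≤ |φ (a + b)| + |φ a| := abs_sub _ _
      _ ≤ |M| + |M| := add_le_add ((hM _ habmem).trans (le_abs_self M))
          ((hM _ hamem).trans (le_abs_self M))
      _ ≤ ε + 2 * |M| / η ^ k * |b| ^ k := by linarith

namespace VanishesToOrder

variable {k : ℕ} {φ : ℝ → ℝ}

theorem exists_abs_add_sub_le_of_small (hφ : VanishesToOrder k φ) {ε : ℝ} (hε : 0 < ε) :
    ∃ δ > 0, ∀ a b : ℝ, |a| < δ → |b| < δ →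
      |φ (a + b) - φ a| ≤ ε * |a| ^ k + ε * |b| ^ k := by
  obtain ⟨δ, hδ, hsmall⟩ := hφ.exists_abs_le (ε := ε / (2 ^ k + 1)) (by positivity)
  refine ⟨δ / 2, half_pos hδ, fun a b ha hb => ?_⟩
  have hpow : |a + b| ^ k ≤ 2 ^ k * (|a| ^ k + |b| ^ k) := by
    have hmax : |a + b| ≤ 2 * max |a| |b| := by
      linarith [abs_add_le a b, le_max_left |a| |b|, le_max_right |a| |b|]
    calc |a + b| ^ k ≤ (2 * max |a| |b|) ^ k := by gcongr
      _ = 2 ^ k * max |a| |b| ^ k := mul_pow _ _ _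
      _ ≤ 2 ^ k * (|a| ^ k + |b| ^ k) := by
        gcongr
        rcases max_choice |a| |b| with h | h <;> rw [h] <;> simp
  calc |φ (a + b) - φ a| ≤ |φ (a + b)| + |φ a| := abs_sub _ _
    _ ≤ ε / (2 ^ k + 1) * |a + b| ^ k + ε / (2 ^ k + 1) * |a| ^ k :=
        add_le_add (hsmall _ (by linarith [abs_add_le a b])) (hsmall _ (by linarith))
    _ ≤ ε / (2 ^ k + 1) * (2 ^ k * (|a| ^ k + |b| ^ k))
          + ε / (2 ^ k + 1) * (|a| ^ k + |b| ^ k) := by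
        gcongr
        exact le_add_of_nonneg_right (by positivity)
    _ = ε * |a| ^ k + ε * |b| ^ k := by field_simp

theorem exists_abs_add_sub_le (hφ : VanishesToOrder k φ) (B : ℝ) {ε : ℝ} (hε : 0 < ε) :
    ∃ K ≥ 0, ∀ a b : ℝ, |a| ≤ B → |b| ≤ B →
      |φ (a + b) - φ a| ≤ ε * |a| ^ k + K * |b| ^ k := by
  obtain ⟨δ, hδ, hsmall⟩ := hφ.exists_abs_add_sub_le_of_small hε
  obtain ⟨K, hK, hbdd⟩ := exists_abs_add_sub_le_of_continuous hφ.continuous k B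
    (ε := ε * δ ^ k) (by positivity)
  refine ⟨ε + K, by positivity, fun a b ha hb => ?_⟩
  have hsum := hbdd a b ha hb
  have hεa : 0 ≤ ε * |a| ^ k := by positivity
  have hεb : 0 ≤ ε * |b| ^ k := by positivity
  have hKb : 0 ≤ K * |b| ^ k := by positivity
  rw [add_mul]
  rcases le_or_gt δ |a| with ha' | ha'
  · have : ε * δ ^ k ≤ ε * |a| ^ k := by gcongr
    linarith
  rcases le_or_gt δ |b| with hb' | hb'
  · have : ε * δ ^ k ≤ ε * |b| ^ k := by gcongr
    linarith
  · linarith [hsmall a b ha' hb']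

theorem exists_abs_le_mul (hφ : VanishesToOrder k φ) (hk : k ≠ 0) (B : ℝ) :
    ∃ K ≥ 0, ∀ b : ℝ, |b| ≤ B → |φ b| ≤ K * |b| ^ k := by
  obtain ⟨K, hK, h⟩ := hφ.exists_abs_add_sub_le B one_pos
  refine ⟨K, hK, fun b hb => ?_⟩
  simpa [hφ.apply_zero hk, hk] using h 0 b (by simpa using (abs_nonneg b).trans hb) hb

end VanishesToOrder

/-! ### Superposition on sequence spaces -/

section Superposition

variable {ι : Type*} {φ : ℝ → ℝ}

section GeneralExponent

variable {p : ℝ≥0∞} [Fact (1 ≤ p)]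

theorem lp_abs_apply_le (v : ℓ^p(ι, ℝ)) (x : ι) : |v x| ≤ ‖v‖ :=
  lp.norm_apply_le_norm (zero_lt_one.trans_le Fact.out).ne' v x

theorem VanishesToOrder.memℓp (hφ : VanishesToOrder 1 φ) (v : ℓ^p(ι, ℝ)) :
    Memℓp (fun x => φ (v x)) p := by
  obtain ⟨K, -, h⟩ := hφ.exists_abs_le_mul one_ne_zero ‖v‖
  refine ((lp.memℓp v).norm.const_mul K).mono fun x => ?_
  simpa using h (v x) (lp_abs_apply_le v x)

/-- The superposition (Nemytskii) operator `v ↦ φ ∘ v`, which maps `ℓᵖ` to itself because the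
elements of `ℓᵖ` are bounded. -/
def superposition (hφ : VanishesToOrder 1 φ) (v : ℓ^p(ι, ℝ)) : ℓ^p(ι, ℝ) :=
  ⟨fun x => φ (v x), hφ.memℓp v⟩

@[simp]
theorem superposition_apply (hφ : VanishesToOrder 1 φ) (v : ℓ^p(ι, ℝ)) (x : ι) :
    superposition hφ v x = φ (v x) := rfl

theorem exists_norm_superposition_sub_le (hφ : VanishesToOrder 1 φ) (B : ℝ) {ε : ℝ}
    (hε : 0 < ε) : ∃ K ≥ 0, ∀ v w : ℓ^p(ι, ℝ), ‖v‖ ≤ B → ‖w‖ ≤ B →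
      ‖superposition hφ (v + w) - superposition hφ v‖ ≤ ε * ‖v‖ + K * ‖w‖ := by
  obtain ⟨K, hK, h⟩ := hφ.exists_abs_add_sub_le B hε
  refine ⟨K, hK, fun v w hv hw => ?_⟩
  calc ‖superposition hφ (v + w) - superposition hφ v‖
      ≤ ‖ε • lp.toNorm v + K • lp.toNorm w‖ := by
        refine lp.norm_mono (zero_lt_one.trans_le Fact.out).ne' fun x => ?_
        have hx := h (v x) (w x) ((lp_abs_apply_le v x).trans hv) ((lp_abs_apply_le w x).trans hw)
        simp only [pow_one] at hx
        exact hx.trans (le_abs_self (ε * |v x| + K * |w x|))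
    _ ≤ ε * ‖v‖ + K * ‖w‖ := by
        refine (norm_add_le _ _).trans (le_of_eq ?_)
        rw [norm_smul, norm_smul, lp.norm_toNorm, lp.norm_toNorm, Real.norm_of_nonneg hε.le,
          Real.norm_of_nonneg hK]

theorem continuous_superposition (hφ : VanishesToOrder 1 φ) :
    Continuous (superposition hφ : ℓ^p(ι, ℝ) → ℓ^p(ι, ℝ)) := by
  rw [Metric.continuous_iff]
  intro v ε hε
  obtain ⟨K, hK, h⟩ := exists_norm_superposition_sub_le (ι := ι) (p := p) hφ (‖v‖ + 1)
    (ε := ε / 2 / (‖v‖ + 1)) (by positivity)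
  refine ⟨min 1 (ε / 2 / (K + 1)), by positivity, fun w hw => ?_⟩
  rw [dist_eq_norm, lt_min_iff] at hw
  have hsub := h v (w - v) (by linarith) (by linarith [norm_nonneg v])
  rw [add_sub_cancel] at hsub
  calc dist (superposition hφ w) (superposition hφ v)
      ≤ ε / 2 / (‖v‖ + 1) * ‖v‖ + K * ‖w - v‖ := by rwa [dist_eq_norm]
    _ < ε / 2 / (‖v‖ + 1) * (‖v‖ + 1) + (K + 1) * (ε / 2 / (K + 1)) := by
        refine add_lt_add_of_lt_of_le ?_ ?_
        · gcongr
          linarith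
        · gcongr
          · linarith
          · exact hw.2.le
    _ = ε := by field_simp; norm_num

theorem exists_subseq_tendsto_apply [Countable ι] {w : ℕ → ℓ^p(ι, ℝ)} {B : ℝ}
    (hB : ∀ n, ‖w n‖ ≤ B) :
    ∃ (v : ℓ^p(ι, ℝ)) (k : ℕ → ℕ), StrictMono k ∧
      ∀ x, Tendsto (fun n => w (k n) x) atTop (𝓝 (v x)) := by
  have hcpt : IsCompact (Set.univ.pi fun _ : ι => Set.Icc (-B) B) :=
    isCompact_univ_pi fun _ => isCompact_Icc
  obtain ⟨v, -, k, hk, hv⟩ := hcpt.tendsto_subseq (x := fun n x => w n x) fun n x _ =>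
    abs_le.mp ((lp_abs_apply_le (w n) x).trans (hB n))
  have hbdd : Bornology.IsBounded (Set.range fun n => w (k n)) :=
    (Metric.isBounded_closedBall (x := 0) (r := B)).subset
      (Set.range_subset_iff.mpr fun n => by simpa using hB (k n))
  exact ⟨⟨v, lp.memℓp_of_tendsto (l := atTop) hbdd hv⟩, k, hk, tendsto_pi_nhds.mp hv⟩

end GeneralExponent

theorem lp_hasSum_sq (v : ℓ²(ι, ℝ)) : HasSum (fun x => v x ^ 2) (‖v‖ ^ 2) := by
  simpa using lp.hasSum_norm (p := 2) (by norm_num) v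

theorem lp_summable_mul (v w : ℓ²(ι, ℝ)) : Summable fun x => |v x| * |w x| :=
  lp.summable_mul (by simpa using Real.HolderConjugate.two_two) v w

theorem lp_tsum_mul_le (v w : ℓ²(ι, ℝ)) : ∑' x, |v x| * |w x| ≤ ‖v‖ * ‖w‖ :=
  lp.tsum_mul_le_mul_norm' (by simpa using Real.HolderConjugate.two_two) v w

theorem VanishesToOrder.summable (hφ : VanishesToOrder 2 φ) (v : ℓ²(ι, ℝ)) :
    Summable fun x => φ (v x) := by
  obtain ⟨K, -, h⟩ := hφ.exists_abs_le_mul two_ne_zero ‖v‖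
  refine Summable.of_norm_bounded ((lp_hasSum_sq v).summable.mul_left K) fun x => ?_
  simpa using h (v x) (lp_abs_apply_le v x)

theorem VanishesToOrder.exists_abs_tsum_le (hφ : VanishesToOrder 2 φ) {ε : ℝ} (hε : 0 < ε) :
    ∃ δ > 0, ∀ v : ℓ²(ι, ℝ), (∀ x, |v x| < δ) → |∑' x, φ (v x)| ≤ ε * ‖v‖ ^ 2 := by
  obtain ⟨δ, hδ, h⟩ := hφ.exists_abs_le hε
  refine ⟨δ, hδ, fun v hv => ?_⟩
  rw [← Real.norm_eq_abs]
  refine tsum_of_norm_bounded ((lp_hasSum_sq v).mul_left ε) fun x => ?_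
  simpa using h (v x) (hv x)

theorem hasSum_inner_superposition (hφ : VanishesToOrder 1 φ) (v w : ℓ²(ι, ℝ)) :
    HasSum (fun x => φ (v x) * w x) (inner ℝ (superposition hφ v) w) := by
  simpa [mul_comm] using lp.hasSum_inner (𝕜 := ℝ) (superposition hφ v) w

theorem VanishesToOrder.exists_abs_primitive_sub_le (hφ : VanishesToOrder 1 φ) (B : ℝ) {ε : ℝ}
    (hε : 0 < ε) : ∃ K ≥ 0, ∀ a b : ℝ, |a| ≤ B → |b| ≤ B →
      |(∫ t in (0 : ℝ)..a + b, φ t) - (∫ t in (0 : ℝ)..a, φ t) - φ a * b|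
        ≤ ε * (|a| * |b|) + K * (|b| * |b|) := by
  obtain ⟨K, hK, h⟩ := hφ.exists_abs_add_sub_le B hε
  refine ⟨K, hK, fun a b ha hb => ?_⟩
  have hint (c d : ℝ) : IntervalIntegrable φ volume c d := hφ.continuous.intervalIntegrable c d
  have heq : (∫ t in (0 : ℝ)..a + b, φ t) - (∫ t in (0 : ℝ)..a, φ t) - φ a * b
      = ∫ t in a..a + b, (φ t - φ a) := by
    rw [intervalIntegral.integral_sub (hint _ _) (by simp),
      intervalIntegral.integral_interval_sub_left (hint _ _) (hint _ _),
      intervalIntegral.integral_const, add_sub_cancel_left, smul_eq_mul, mul_comm]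
  have hbound : ∀ t ∈ Set.uIoc a (a + b), ‖φ t - φ a‖ ≤ ε * |a| + K * |b| := fun t ht => by
    have htb : |t - a| ≤ |b| := by
      simpa using Set.abs_sub_left_of_mem_uIcc (Set.uIoc_subset_uIcc ht)
    have hφt := h a (t - a) ha (htb.trans hb)
    rw [add_sub_cancel, pow_one, pow_one] at hφt
    exact hφt.trans (by gcongr)
  rw [heq]
  refine (intervalIntegral.norm_integral_le_of_norm_le_const hbound).trans (le_of_eq ?_)
  rw [add_sub_cancel_left]
  ring

theorem hasFDerivAt_tsum_primitive (hφ : VanishesToOrder 1 φ) (v : ℓ²(ι, ℝ)) :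
    HasFDerivAt (fun v : ℓ²(ι, ℝ) => ∑' x, ∫ t in (0 : ℝ)..v x, φ t)
      (innerSL ℝ (superposition hφ v)) v := by
  rw [hasFDerivAt_iff_isLittleO_nhds_zero]
  refine IsLittleO.of_bound fun c hc => ?_
  obtain ⟨K, hK, h⟩ := hφ.exists_abs_primitive_sub_le (‖v‖ + 1) (ε := c / 2 / (‖v‖ + 1))
    (by positivity)
  have hr : 0 < min 1 (c / 2 / (K + 1)) := by positivity
  filter_upwards [Metric.ball_mem_nhds (0 : ℓ²(ι, ℝ)) hr] with w hw
  rw [mem_ball_zero_iff, lt_min_iff] at hw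
  have hterm (x : ι) := h (v x) (w x) ((lp_abs_apply_le v x).trans (by linarith))
    ((lp_abs_apply_le w x).trans (by linarith [norm_nonneg v]))
  have hF := hφ.primitive
  rw [innerSL_apply_apply, ← (hasSum_inner_superposition hφ v w).tsum_eq,
    ← (hF.summable _).tsum_sub (hF.summable _),
    ← ((hF.summable _).sub (hF.summable _)).tsum_sub (hasSum_inner_superposition hφ v w).summable]
  calc _ ≤ c / 2 / (‖v‖ + 1) * (∑' x, |v x| * |w x|) + K * ∑' x, |w x| * |w x| :=
        tsum_of_norm_bounded (((lp_summable_mul v w).hasSum.mul_left _).add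
          ((lp_summable_mul w w).hasSum.mul_left K)) hterm
    _ ≤ c / 2 / (‖v‖ + 1) * ((‖v‖ + 1) * ‖w‖) + (K + 1) * (c / 2 / (K + 1) * ‖w‖) := by
        gcongr
        · exact (lp_tsum_mul_le v w).trans (by gcongr; linarith)
        · linarith
        · exact (lp_tsum_mul_le w w).trans (by gcongr; exact hw.2.le)
    _ = c * ‖w‖ := by field_simp; ring

theorem hasStrictFDerivAt_tsum_primitive (hφ : VanishesToOrder 1 φ) (v : ℓ²(ι, ℝ)) :
    HasStrictFDerivAt (fun v : ℓ²(ι, ℝ) => ∑' x, ∫ t in (0 : ℝ)..v x, φ t)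
      (innerSL ℝ (superposition hφ v)) v :=
  hasStrictFDerivAt_of_hasFDerivAt_of_continuousAt
    (.of_forall fun w => hasFDerivAt_tsum_primitive hφ w)
    ((innerSL ℝ).continuous.comp (continuous_superposition hφ)).continuousAt

end Superposition

/-! ### Weak limits in `ℓ²` and Brezis–Lieb splitting -/

section Splitting

variable {ι β : Type*} {l : Filter β}

theorem tendsto_tsum_zero_of_almost_dominated {E : Type*} [NormedAddCommGroup E]
    {ψ : β → ι → E} {r : β → ι → ℝ} {B : ℝ} (hr : ∀ n x, 0 ≤ r n x)
    (hrs : ∀ n, Summable (r n)) (hB : ∀ n, ∑' x, r n x ≤ B)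
    (hψ : ∀ x, Tendsto (fun n => ψ n x) l (𝓝 0))
    (hdom : ∀ ε > 0, ∃ b : ι → ℝ, Summable b ∧ ∀ n x, ‖ψ n x‖ ≤ ε * r n x + b x) :
    Tendsto (fun n => ∑' x, ψ n x) l (𝓝 0) := by
  rw [Metric.tendsto_nhds]
  intro ε hε
  obtain ⟨b, hb, hle⟩ := hdom (ε / 2 / (|B| + 1)) (by positivity)
  set η := ε / 2 / (|B| + 1)
  -- The part of `‖ψ‖` not absorbed by `η * r` is dominated by `b`.
  set rest : β → ι → ℝ := fun n x => max (‖ψ n x‖ - η * r n x) 0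
  have hrest_le (n x) : rest n x ≤ |b x| :=
    max_le (by linarith [hle n x, le_abs_self (b x)]) (abs_nonneg _)
  have hrest_nonneg (n x) : 0 ≤ rest n x := le_max_right _ _
  have hrest_lim : Tendsto (fun n => ∑' x, rest n x) l (𝓝 0) := by
    rw [← tsum_zero (β := ι)]
    refine tendsto_tsum_of_dominated_convergence hb.abs (fun x => ?_) (.of_forall fun n x => ?_)
    · refine squeeze_zero (fun n => hrest_nonneg n x) (fun n => max_le ?_ (norm_nonneg _))
        (tendsto_zero_iff_norm_tendsto_zero.mp (hψ x))
      exact sub_le_self _ (mul_nonneg (by positivity) (hr n x))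
    · rw [Real.norm_of_nonneg (hrest_nonneg n x)]
      exact hrest_le n x
  filter_upwards [hrest_lim.eventually_lt_const (half_pos hε)] with n hn
  have hrest_summable : Summable (rest n) := hb.abs.of_nonneg_of_le (hrest_nonneg n) (hrest_le n)
  rw [dist_zero_right]
  calc ‖∑' x, ψ n x‖ ≤ ∑' x, rest n x + η * ∑' x, r n x :=
        tsum_of_norm_bounded (hrest_summable.hasSum.add ((hrs n).hasSum.mul_left η)) fun x => by
          linarith [le_max_left (‖ψ n x‖ - η * r n x) 0]
    _ ≤ ∑' x, rest n x + η * (|B| + 1) := by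
        gcongr
        linarith [hB n, le_abs_self B]
    _ < ε := by
        have : η * (|B| + 1) = ε / 2 := by simp only [η]; field_simp
        linarith

theorem VanishesToOrder.tendsto_tsum_add_sub {φ : ℝ → ℝ} (hφ : VanishesToOrder 2 φ)
    (v : ℓ²(ι, ℝ)) {w : β → ℓ²(ι, ℝ)} {B : ℝ} (hB : ∀ n, ‖w n‖ ≤ B)
    (hw : ∀ x, Tendsto (fun n => w n x) l (𝓝 0)) :
    Tendsto (fun n => ∑' x, φ ((v + w n) x) - ∑' x, φ (w n x)) l (𝓝 (∑' x, φ (v x))) := by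
  rw [← tendsto_sub_nhds_zero_iff]
  have hEq (n : β) : (∑' x, φ ((v + w n) x) - ∑' x, φ (w n x)) - ∑' x, φ (v x)
      = ∑' x, (φ ((v + w n) x) - φ (w n x) - φ (v x)) := by
    rw [((hφ.summable _).sub (hφ.summable _)).tsum_sub (hφ.summable _),
      (hφ.summable _).tsum_sub (hφ.summable _)]
  simp_rw [hEq]
  refine tendsto_tsum_zero_of_almost_dominated (r := fun n x => w n x ^ 2) (B := B ^ 2)
    (fun n x => sq_nonneg _) (fun n => (lp_hasSum_sq (w n)).summable)
    (fun n => ?_) (fun x => ?_) fun ε hε => ?_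
  · rw [(lp_hasSum_sq (w n)).tsum_eq]
    gcongr
    exact hB n
  · have hlim : Tendsto (fun n => φ (v x + w n x) - φ (w n x) - φ (v x)) l
        (𝓝 (φ (v x + 0) - φ 0 - φ (v x))) :=
      ((hφ.continuous.tendsto _).comp (tendsto_const_nhds.add (hw x))).sub
        ((hφ.continuous.tendsto _).comp (hw x)) |>.sub tendsto_const_nhds
    simpa [hφ.apply_zero two_ne_zero] using hlim
  · obtain ⟨K, -, hK⟩ := hφ.exists_abs_add_sub_le (max B ‖v‖) hε
    obtain ⟨L, -, hL⟩ := hφ.exists_abs_le_mul two_ne_zero ‖v‖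
    refine ⟨fun x => (K + L) * v x ^ 2, (lp_hasSum_sq v).summable.mul_left _, fun n x => ?_⟩
    have hincr := hK (w n x) (v x)
      (((lp_abs_apply_le _ x).trans (hB n)).trans (le_max_left _ _))
      ((lp_abs_apply_le _ x).trans (le_max_right _ _))
    have hsize := hL (v x) (lp_abs_apply_le _ x)
    rw [sq_abs] at hincr hsize
    rw [sq_abs] at hincr
    rw [lp.coeFn_add, Pi.add_apply, add_comm (v x)]
    calc ‖φ (w n x + v x) - φ (w n x) - φ (v x)‖
        ≤ |φ (w n x + v x) - φ (w n x)| + |φ (v x)| := abs_sub _ _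
      _ ≤ ε * w n x ^ 2 + (K + L) * v x ^ 2 := by linarith

theorem lp_tendsto_dual_zero {w : β → ℓ²(ι, ℝ)} {B : ℝ} (hB : ∀ n, ‖w n‖ ≤ B)
    (hw : ∀ x, Tendsto (fun n => w n x) l (𝓝 0)) (L : ℓ²(ι, ℝ) →L[ℝ] ℝ) :
    Tendsto (fun n => L (w n)) l (𝓝 0) := by
  obtain ⟨a, rfl⟩ := (InnerProductSpace.toDual ℝ ℓ²(ι, ℝ)).surjective L
  simp only [InnerProductSpace.toDual_apply_apply, lp.inner_eq_tsum, Real.inner_apply]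
  refine tendsto_tsum_zero_of_almost_dominated (r := fun n x => w n x ^ 2) (B := B ^ 2)
    (fun n x => sq_nonneg _) (fun n => (lp_hasSum_sq (w n)).summable)
    (fun n => ?_) (fun x => ?_) fun ε hε => ?_
  · rw [(lp_hasSum_sq (w n)).tsum_eq]
    gcongr
    exact hB n
  · simpa using (hw x).const_mul (a x)
  · refine ⟨fun x => 1 / ε * a x ^ 2, (lp_hasSum_sq a).summable.mul_left _, fun n x => ?_⟩
    beta_reduce
    rw [Real.norm_eq_abs, abs_mul, ← sq_abs (w n x), ← sq_abs (a x)]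
    have hsquare : ε * |w n x| ^ 2 + 1 / ε * |a x| ^ 2 - |a x| * |w n x|
        = (ε * |w n x| - |a x|) ^ 2 / ε + |a x| * |w n x| := by field_simp; ring
    have : 0 ≤ (ε * |w n x| - |a x|) ^ 2 / ε + |a x| * |w n x| := by positivity
    linarith

end Splitting

/-! ### Autonomous nonlinearities -/

/-- The conditions `(f₁)`, `(f₃)`, `(f₄)` and `(f₅)` for a nonlinearity that does not depend on the
lattice site. -/
structure Nonlinearity (g : ℝ → ℝ) : Prop where
  vanishes : VanishesToOrder 1 g
  strictMonoOn_neg : StrictMonoOn (fun u => g u / |u|) (Set.Iio 0)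
  strictMonoOn_pos : StrictMonoOn (fun u => g u / |u|) (Set.Ioi 0)
  superquadratic :
    Tendsto (fun u => (∫ t in (0 : ℝ)..u, g t) / u ^ 2) (Bornology.cobounded ℝ) atTop

/-- The density `g(u) u / 2 - ∫₀ᵘ g` of the energy on the Nehari manifold. -/
def excessDensity (g : ℝ → ℝ) (u : ℝ) : ℝ := 1 / 2 * (g u * u) - ∫ t in (0 : ℝ)..u, g t

namespace Nonlinearity

variable {g : ℝ → ℝ}

theorem of_forall_exists (hcont : Continuous g)
    (hzero : ∀ ε : ℝ, 0 < ε → ∃ δ : ℝ, 0 < δ ∧ ∀ u, |u| < δ → |g u| ≤ ε * |u|)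
    (hneg : StrictMonoOn (fun u => g u / |u|) (Set.Iio 0))
    (hpos : StrictMonoOn (fun u => g u / |u|) (Set.Ioi 0))
    (htop : ∀ M : ℝ, ∃ R : ℝ, ∀ u, R ≤ |u| → M ≤ (∫ t in (0 : ℝ)..u, g t) / u ^ 2) :
    Nonlinearity g where
  vanishes.continuous := hcont
  vanishes.isLittleO := by
    refine IsLittleO.of_bound fun ε hε => ?_
    obtain ⟨δ, hδ, hle⟩ := hzero ε hε
    filter_upwards [Metric.ball_mem_nhds 0 hδ] with u hu
    simpa using hle u (by simpa using hu)
  strictMonoOn_neg := hneg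
  strictMonoOn_pos := hpos
  superquadratic := by
    refine tendsto_atTop.mpr fun M => ?_
    obtain ⟨R, hle⟩ := htop M
    filter_upwards [eventually_cobounded_le_norm R] with u hu
    exact hle u hu

theorem mul_lt_of_lt_one (hg : Nonlinearity g) {t u : ℝ} (ht0 : 0 < t) (ht1 : t < 1)
    (hu : u ≠ 0) : g (t * u) * u < t * (g u * u) := by
  rcases lt_or_gt_of_ne hu with hu | hu
  · have htu : t * u < 0 := mul_neg_of_pos_of_neg ht0 hu
    have hmono := hg.strictMonoOn_neg hu htu (by nlinarith)
    simp only [abs_of_neg hu, abs_of_neg htu] at hmono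
    rw [div_lt_div_iff₀ (by linarith) (by linarith)] at hmono
    nlinarith
  · have htu : 0 < t * u := mul_pos ht0 hu
    have hmono := hg.strictMonoOn_pos htu hu (by nlinarith)
    simp only [abs_of_pos hu, abs_of_pos htu] at hmono
    rw [div_lt_div_iff₀ (by linarith) (by linarith)] at hmono
    nlinarith

theorem lt_mul_of_one_lt (hg : Nonlinearity g) {t u : ℝ} (ht : 1 < t) (hu : u ≠ 0) :
    t * (g u * u) < g (t * u) * u := by
  have ht0 : 0 < t := zero_lt_one.trans ht
  have h := hg.mul_lt_of_lt_one (t := t⁻¹) (u := t * u) (by positivity)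
    (inv_lt_one_of_one_lt₀ ht) (by positivity)
  have hrescale : t⁻¹ * (g (t * u) * (t * u)) = g (t * u) * u := by field_simp
  rw [inv_mul_cancel_left₀ ht0.ne', hrescale] at h
  linarith

theorem mul_le_of_le_one (hg : Nonlinearity g) {t : ℝ} (u : ℝ) (ht0 : 0 ≤ t) (ht1 : t ≤ 1) :
    g (t * u) * u ≤ t * (g u * u) := by
  rcases eq_or_ne u 0 with rfl | hu
  · simp
  rcases ht0.eq_or_lt with rfl | ht0
  · simp [hg.vanishes.apply_zero one_ne_zero]
  rcases ht1.eq_or_lt with rfl | ht1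
  · simp
  exact (hg.mul_lt_of_lt_one ht0 ht1 hu).le

theorem le_mul_of_one_le (hg : Nonlinearity g) {t : ℝ} (u : ℝ) (ht : 1 ≤ t) :
    t * (g u * u) ≤ g (t * u) * u := by
  rcases eq_or_ne u 0 with rfl | hu
  · simp
  rcases ht.eq_or_lt with rfl | ht
  · simp
  exact (hg.lt_mul_of_one_lt ht hu).le

theorem mul_self_nonneg (hg : Nonlinearity g) (u : ℝ) : 0 ≤ g u * u := by
  have hlim : Tendsto (fun t : ℝ => g (t * u) * u / t) (𝓝[>] 0) (𝓝 0) := by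
    have hmul : Tendsto (fun t : ℝ => t * u) (𝓝[>] 0) (𝓝 0) :=
      ((continuous_mul_const u).tendsto' 0 0 (zero_mul u)).mono_left nhdsWithin_le_nhds
    have hlo : (fun t : ℝ => g (t * u) * u) =o[𝓝[>] 0] fun t => t := by
      refine ((hg.vanishes.isLittleO.comp_tendsto hmul).mul_isBigO
        (isBigO_refl (fun _ => u) _)).trans_isBigO ?_
      simpa [Function.comp_def, mul_assoc] using
        (isBigO_refl (fun t : ℝ => t) (𝓝[>] 0)).mul (isBigO_const_one ℝ (u * u) _)
    exact hlo.tendsto_div_nhds_zero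
  refine le_of_tendsto hlim ?_
  filter_upwards [Ioo_mem_nhdsGT zero_lt_one] with t ht
  rw [div_le_iff₀ ht.1, mul_comm (g u * u)]
  exact hg.mul_le_of_le_one u ht.1.le ht.2.le

theorem primitive_sub_eq (g : ℝ → ℝ) (r t u : ℝ) :
    ∫ s in r * u..t * u, g s = ∫ s in r..t, g (s * u) * u := by
  rw [← intervalIntegral.mul_integral_comp_mul_right, intervalIntegral.integral_mul_const,
    mul_comm]

theorem primitive_nonneg (hg : Nonlinearity g) (u : ℝ) : 0 ≤ ∫ t in (0 : ℝ)..u, g t := by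
  have hscale := primitive_sub_eq g 0 1 u
  rw [zero_mul, one_mul] at hscale
  rw [hscale]
  refine intervalIntegral.integral_nonneg zero_le_one fun s hs => ?_
  rcases hs.1.eq_or_lt with rfl | hs0
  · simp [hg.vanishes.apply_zero one_ne_zero]
  · refine nonneg_of_mul_nonneg_right ?_ hs0
    calc (0 : ℝ) ≤ g (s * u) * (s * u) := hg.mul_self_nonneg _
      _ = s * (g (s * u) * u) := by ring

theorem le_primitive_sub (hg : Nonlinearity g) {t : ℝ} (u : ℝ) (ht : 0 ≤ t) :
    (t ^ 2 - 1) / 2 * (g u * u) ≤ (∫ s in (0 : ℝ)..t * u, g s) - ∫ s in (0 : ℝ)..u, g s := by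
  have hcont := hg.vanishes.continuous
  have hint (a b : ℝ) : IntervalIntegrable g volume a b := hcont.intervalIntegrable a b
  have hscale := primitive_sub_eq g 1 t u
  rw [one_mul] at hscale
  have hlin (a b : ℝ) : ∫ s in a..b, s * (g u * u) = (b ^ 2 - a ^ 2) / 2 * (g u * u) := by
    rw [intervalIntegral.integral_mul_const, integral_id]
  have hintl (a b : ℝ) : IntervalIntegrable (fun s => s * (g u * u)) volume a b :=
    Continuous.intervalIntegrable (by fun_prop) a b
  have hintr (a b : ℝ) : IntervalIntegrable (fun s => g (s * u) * u) volume a b :=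
    Continuous.intervalIntegrable (by fun_prop) a b
  rw [intervalIntegral.integral_interval_sub_left (hint _ _) (hint _ _), hscale]
  rcases le_total t 1 with ht1 | ht1
  · have hmono := intervalIntegral.integral_mono_on ht1 (hintr t 1) (hintl t 1) fun s hs =>
      hg.mul_le_of_le_one u (ht.trans hs.1) hs.2
    rw [hlin] at hmono
    rw [intervalIntegral.integral_symm]
    linarith
  · have hmono := intervalIntegral.integral_mono_on ht1 (hintl 1 t) (hintr 1 t) fun s hs =>
      hg.le_mul_of_one_le u hs.1
    rw [hlin] at hmono
    linarith

theorem vanishes_mul (hg : Nonlinearity g) : VanishesToOrder 2 fun u => g u * u :=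
  hg.vanishes.mul_id

theorem vanishes_primitive (hg : Nonlinearity g) :
    VanishesToOrder 2 fun u => ∫ t in (0 : ℝ)..u, g t :=
  hg.vanishes.primitive

theorem vanishes_excessDensity (hg : Nonlinearity g) : VanishesToOrder 2 (excessDensity g) :=
  (hg.vanishes_mul.const_mul (1 / 2)).sub hg.vanishes_primitive

theorem excessDensity_mul_le (hg : Nonlinearity g) {t : ℝ} (u : ℝ) (ht0 : 0 ≤ t)
    (ht1 : t ≤ 1) : excessDensity g (t * u) ≤ excessDensity g u := by
  have hF := hg.le_primitive_sub u ht0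
  have hgu := mul_le_mul_of_nonneg_left (hg.mul_le_of_le_one u ht0 ht1) ht0
  simp only [excessDensity]
  nlinarith

theorem excessDensity_nonneg (hg : Nonlinearity g) (u : ℝ) : 0 ≤ excessDensity g u := by
  simpa [excessDensity] using hg.excessDensity_mul_le u le_rfl zero_le_one

theorem excessDensity_pos (hg : Nonlinearity g) {u : ℝ} (hu : u ≠ 0) :
    0 < excessDensity g u := by
  have hhalf := hg.excessDensity_nonneg (1 / 2 * u)
  have hF := hg.le_primitive_sub (t := 1 / 2) u (by norm_num)
  have hgu := hg.mul_lt_of_lt_one (t := 1 / 2) (by norm_num) (by norm_num) hu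
  simp only [excessDensity] at hhalf ⊢
  nlinarith

end Nonlinearity

/-! ### The Nehari manifold -/

section Variational

variable {ι : Type*} {H : Type*} [NormedAddCommGroup H] [InnerProductSpace ℝ H]
  (T : H ≃L[ℝ] ℓ²(ι, ℝ)) (g : ℝ → ℝ)

/-- The energy `‖u‖² / 2 - ∑ₓ ∫₀^{u(x)} g`, where `T` assigns to `u` its coordinates `u(x)`. -/
def coordEnergy (u : H) : ℝ := 1 / 2 * ‖u‖ ^ 2 - ∑' x, ∫ t in (0 : ℝ)..T u x, g t

/-- The derivative of the energy at `u` in the direction `u`, see `fderiv_coordEnergy_self`. -/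
def nehariForm (u : H) : ℝ := ‖u‖ ^ 2 - ∑' x, g (T u x) * T u x

/-- The Nehari manifold of the energy, on which every nontrivial critical point lies. -/
def nehariManifold : Set H := {u | u ≠ 0 ∧ nehariForm T g u = 0}

/-- The functional that agrees with the energy on the Nehari manifold and, unlike the energy, is
nonnegative and monotone along rays. -/
def excess (u : H) : ℝ := ∑' x, excessDensity g (T u x)

variable {T g}

theorem map_smul_apply (t : ℝ) (u : H) (x : ι) : T (t • u) x = t * T u x := by
  rw [map_smul, lp.coeFn_smul, Pi.smul_apply, smul_eq_mul]

theorem exists_coord_ne_zero {u : H} (hu : u ≠ 0) : ∃ x, T u x ≠ 0 := by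
  contrapose! hu
  exact T.map_eq_zero_iff.mp (lp.ext (funext hu))

theorem VanishesToOrder.exists_tsum_coord_le {φ : ℝ → ℝ} (hφ : VanishesToOrder 2 φ) {ε : ℝ}
    (hε : 0 < ε) :
    ∃ δ > 0, ∀ u : H, (∀ x, |T u x| < δ) → ∑' x, φ (T u x) ≤ ε * ‖u‖ ^ 2 := by
  set C := ‖(T : H →L[ℝ] ℓ²(ι, ℝ))‖ + 1
  have hC : 0 < C := by positivity
  obtain ⟨δ, hδ, h⟩ := hφ.exists_abs_tsum_le (ι := ι) (ε := ε / C ^ 2) (by positivity)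
  refine ⟨δ, hδ, fun u hu => ?_⟩
  have hTu : ‖T u‖ ≤ C * ‖u‖ :=
    (T : H →L[ℝ] ℓ²(ι, ℝ)).le_of_opNorm_le (by simp [C]) u
  calc ∑' x, φ (T u x) ≤ ε / C ^ 2 * ‖T u‖ ^ 2 := (le_abs_self _).trans (h (T u) hu)
    _ ≤ ε / C ^ 2 * (C * ‖u‖) ^ 2 := by gcongr
    _ = ε * ‖u‖ ^ 2 := by field_simp

namespace Nonlinearity

theorem hasStrictFDerivAt_coordEnergy (hg : Nonlinearity g) (u : H) :
    HasStrictFDerivAt (coordEnergy T g)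
      (innerSL ℝ u - (innerSL ℝ (superposition hg.vanishes (T u))).comp
        (T : H →L[ℝ] ℓ²(ι, ℝ))) u := by
  have hsq : HasStrictFDerivAt (fun u : H => 1 / 2 * ‖u‖ ^ 2) (innerSL ℝ u) u := by
    refine ((hasStrictFDerivAt_norm_sq u).const_mul (1 / 2 : ℝ)).congr_fderiv ?_
    rw [← Nat.cast_smul_eq_nsmul ℝ, smul_smul]
    norm_num
  exact hsq.sub ((hasStrictFDerivAt_tsum_primitive hg.vanishes (T u)).comp u
    T.hasStrictFDerivAt)

theorem nehariForm_eq (hg : Nonlinearity g) (u : H) :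
    nehariForm T g u = ‖u‖ ^ 2 - inner ℝ (superposition hg.vanishes (T u)) (T u) := by
  rw [nehariForm, (hasSum_inner_superposition hg.vanishes (T u) (T u)).tsum_eq]

theorem fderiv_coordEnergy_self (hg : Nonlinearity g) (u : H) :
    fderiv ℝ (coordEnergy T g) u u = nehariForm T g u := by
  rw [(hg.hasStrictFDerivAt_coordEnergy u).hasFDerivAt.fderiv, hg.nehariForm_eq]
  simp

theorem nehariManifold_eq (hg : Nonlinearity g) :
    nehariManifold T g = {u | u ≠ 0 ∧ fderiv ℝ (coordEnergy T g) u u = 0} := by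
  simp only [nehariManifold, hg.fderiv_coordEnergy_self]

theorem continuous_nehariForm (hg : Nonlinearity g) : Continuous (nehariForm T g) := by
  simp_rw [funext hg.nehariForm_eq]
  exact (continuous_norm.pow 2).sub
    (((continuous_superposition hg.vanishes).comp T.continuous).inner T.continuous)

theorem coordEnergy_eq (hg : Nonlinearity g) (u : H) :
    coordEnergy T g u = 1 / 2 * nehariForm T g u + excess T g u := by
  simp only [coordEnergy, nehariForm, excess, excessDensity]
  rw [((hg.vanishes_mul.summable (T u)).mul_left (1 / 2)).tsum_sub
    (hg.vanishes_primitive.summable (T u)), tsum_mul_left]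
  ring

theorem coordEnergy_eq_excess (hg : Nonlinearity g) {u : H} (hu : u ∈ nehariManifold T g) :
    coordEnergy T g u = excess T g u := by
  rw [hg.coordEnergy_eq, hu.2, mul_zero, zero_add]

theorem excess_nonneg (hg : Nonlinearity g) (u : H) : 0 ≤ excess T g u :=
  tsum_nonneg fun _ => hg.excessDensity_nonneg _

theorem excess_pos (hg : Nonlinearity g) {u : H} (hu : u ≠ 0) : 0 < excess T g u := by
  obtain ⟨x, hx⟩ := exists_coord_ne_zero (T := T) hu
  exact (hg.vanishes_excessDensity.summable (T u)).tsum_pos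
    (fun _ => hg.excessDensity_nonneg _) x (hg.excessDensity_pos hx)

theorem excess_smul_le (hg : Nonlinearity g) (u : H) {t : ℝ} (ht0 : 0 ≤ t) (ht1 : t ≤ 1) :
    excess T g (t • u) ≤ excess T g u := by
  refine (hg.vanishes_excessDensity.summable (T (t • u))).tsum_le_tsum (fun x => ?_)
    (hg.vanishes_excessDensity.summable (T u))
  rw [map_smul_apply]
  exact hg.excessDensity_mul_le _ ht0 ht1

theorem hasSum_nehariForm_smul (hg : Nonlinearity g) {u : H} (hu : u ∈ nehariManifold T g)
    (t : ℝ) :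
    HasSum (fun x => t * (t * (g (T u x) * T u x) - g (t * T u x) * T u x))
      (nehariForm T g (t • u)) := by
  have hnorm : ‖t • u‖ ^ 2 = t ^ 2 * ∑' x, g (T u x) * T u x := by
    rw [norm_smul, mul_pow, Real.norm_eq_abs, sq_abs, sub_eq_zero.mp hu.2]
  have hterm (x : ι) : t * (t * (g (T u x) * T u x) - g (t * T u x) * T u x) =
      t ^ 2 * (g (T u x) * T u x) - g (T (t • u) x) * T (t • u) x := by
    rw [map_smul_apply]
    ring
  rw [nehariForm, hnorm]
  exact (((hg.vanishes_mul.summable (T u)).hasSum.mul_left (t ^ 2)).sub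
    (hg.vanishes_mul.summable (T (t • u))).hasSum).congr_fun hterm

theorem nehariForm_smul_pos (hg : Nonlinearity g) {u : H} (hu : u ∈ nehariManifold T g) {t : ℝ}
    (ht0 : 0 < t) (ht1 : t < 1) : 0 < nehariForm T g (t • u) := by
  obtain ⟨x, hx⟩ := exists_coord_ne_zero (T := T) hu.1
  have hsum := hg.hasSum_nehariForm_smul hu t
  rw [← hsum.tsum_eq]
  exact hsum.summable.tsum_pos
    (fun y => mul_nonneg ht0.le (sub_nonneg.mpr (hg.mul_le_of_le_one _ ht0.le ht1.le))) x
    (mul_pos ht0 (sub_pos.mpr (hg.mul_lt_of_lt_one ht0 ht1 hx)))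

theorem nehariForm_smul_neg (hg : Nonlinearity g) {u : H} (hu : u ∈ nehariManifold T g) {t : ℝ}
    (ht : 1 < t) : nehariForm T g (t • u) < 0 := by
  obtain ⟨x, hx⟩ := exists_coord_ne_zero (T := T) hu.1
  have ht0 : 0 < t := zero_lt_one.trans ht
  have hsum := (hg.hasSum_nehariForm_smul hu t).neg
  rw [← neg_pos, ← hsum.tsum_eq]
  refine hsum.summable.tsum_pos (fun y => ?_) x ?_
  · exact neg_nonneg.mpr <|
      mul_nonpos_of_nonneg_of_nonpos ht0.le (sub_nonpos.mpr (hg.le_mul_of_one_le _ ht.le))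
  · exact neg_pos.mpr (mul_neg_of_pos_of_neg ht0 (sub_neg.mpr (hg.lt_mul_of_one_lt ht hx)))

theorem coordEnergy_smul_le (hg : Nonlinearity g) {u : H} (hu : u ∈ nehariManifold T g)
    {t : ℝ} (ht : 0 ≤ t) : coordEnergy T g (t • u) ≤ coordEnergy T g u := by
  have hgu := (hg.vanishes_mul.summable (T u)).mul_left ((t ^ 2 - 1) / 2)
  have hFu := hg.vanishes_primitive.summable (T u)
  have hFtu : Summable fun x => ∫ s in (0 : ℝ)..t * T u x, g s :=
    (hg.vanishes_primitive.summable (T (t • u))).congr fun x => by rw [map_smul_apply]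
  have hle := hgu.tsum_le_tsum (fun x => hg.le_primitive_sub (T u x) ht) (hFtu.sub hFu)
  rw [hFtu.tsum_sub hFu, tsum_mul_left, ← sub_eq_zero.mp hu.2] at hle
  simp only [coordEnergy, map_smul_apply]
  rw [norm_smul, mul_pow, Real.norm_eq_abs, sq_abs]
  linarith

theorem exists_nehariForm_pos (hg : Nonlinearity g) :
    ∃ δ > 0, ∀ u : H, u ≠ 0 → (∀ x, |T u x| < δ) → 0 < nehariForm T g u := by
  obtain ⟨δ, hδ, h⟩ := hg.vanishes_mul.exists_tsum_coord_le (T := T) one_half_pos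
  refine ⟨δ, hδ, fun u hu hx => ?_⟩
  have hpos : 0 < ‖u‖ ^ 2 := by positivity
  have hle := h u hx
  rw [nehariForm]
  linarith

theorem exists_smul_mem_nehariManifold (hg : Nonlinearity g) {u : H} (hu : u ≠ 0)
    (hneg : nehariForm T g u ≤ 0) : ∃ t : ℝ, 0 < t ∧ t ≤ 1 ∧ t • u ∈ nehariManifold T g := by
  obtain ⟨δ, hδ, hpos⟩ := hg.exists_nehariForm_pos (T := T)
  have hsmall : ∀ᶠ s : ℝ in 𝓝[>] 0, s * ‖T u‖ < δ :=
    nhdsWithin_le_nhds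
      ((continuous_mul_const ‖T u‖).continuousAt.eventually_lt_const (by simpa using hδ))
  obtain ⟨s, hsδ, hs0, hs1⟩ := (hsmall.and (Ioo_mem_nhdsGT zero_lt_one)).exists
  have hs : 0 < nehariForm T g (s • u) := by
    refine hpos _ (smul_ne_zero hs0.ne' hu) fun x => ?_
    rw [map_smul_apply, abs_mul, abs_of_pos hs0]
    exact (mul_le_mul_of_nonneg_left (lp_abs_apply_le (T u) x) hs0.le).trans_lt hsδ
  have hcont : Continuous fun t : ℝ => nehariForm T g (t • u) :=
    hg.continuous_nehariForm.comp (continuous_id.smul continuous_const)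
  obtain ⟨t, ht, hzero⟩ := intermediate_value_Icc' hs1.le hcont.continuousOn
    ⟨by simpa using hneg, hs.le⟩
  have ht0 : 0 < t := hs0.trans_le ht.1
  exact ⟨t, ht0, ht.2, smul_ne_zero ht0.ne' hu, hzero⟩

theorem nehariManifold_nonempty (hg : Nonlinearity g) [Nonempty ι] :
    (nehariManifold T g).Nonempty := by
  classical
  obtain ⟨o⟩ := ‹Nonempty ι›
  set w : H := T.symm (lp.single 2 o (1 : ℝ))
  have hcoord (t : ℝ) (x : ι) : T (t • w) x = if x = o then t else 0 := by
    rw [map_smul_apply, T.apply_symm_apply]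
    rcases eq_or_ne x o with rfl | hx <;> simp [*]
  have hform (t : ℝ) : nehariForm T g (t • w) = t ^ 2 * ‖w‖ ^ 2 - g t * t := by
    simp_rw [nehariForm, norm_smul, mul_pow, Real.norm_eq_abs, sq_abs, hcoord]
    rw [tsum_eq_single o fun x hx => by simp [hx], if_pos rfl]
  obtain ⟨t, hsup, ht0⟩ := ((hg.superquadratic.eventually_ge_atTop (‖w‖ ^ 2)).and
    (Bornology.eventually_ne_cobounded 0)).exists
  have hneg : nehariForm T g (t • w) ≤ 0 := by
    rw [le_div_iff₀ (by positivity)] at hsup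
    have hexcess := hg.excessDensity_nonneg t
    have hprim := hg.primitive_nonneg t
    rw [excessDensity] at hexcess
    rw [hform]
    linarith
  have hne : t • w ≠ 0 := fun h0 => ht0 (by simpa [h0] using (hcoord t o).symm)
  obtain ⟨s, -, -, hs⟩ := hg.exists_smul_mem_nehariManifold hne hneg
  exact ⟨_, hs⟩

/-! ### Boundedness of the sublevel sets -/

theorem exists_mul_norm_le_abs_coord (hg : Nonlinearity g) (C : ℝ) :
    ∃ κ > 0, ∀ u ∈ nehariManifold T g, coordEnergy T g u ≤ C → ∃ x, κ * ‖u‖ ≤ |T u x| := by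
  obtain ⟨δ, hδ, hsmall⟩ :=
    hg.vanishes_primitive.exists_tsum_coord_le (T := T) (ε := 1 / 4) (by norm_num)
  set s := 2 * (|C| + 1)
  have hs : 0 < s := by positivity
  have hsC : C < 1 / 4 * s ^ 2 := by nlinarith [le_abs_self C, abs_nonneg C]
  refine ⟨δ / s, by positivity, fun u hu hC => ?_⟩
  have hu0 : 0 < ‖u‖ := norm_pos_iff.mpr hu.1
  have hr : 0 < s / ‖u‖ := by positivity
  by_contra! hlt
  have hnorm : ‖(s / ‖u‖) • u‖ = s := by
    rw [norm_smul, Real.norm_of_nonneg hr.le, div_mul_cancel₀ _ hu0.ne']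
  have hsum := hsmall ((s / ‖u‖) • u) fun x => by
    rw [map_smul_apply, abs_mul, abs_of_pos hr]
    calc s / ‖u‖ * |T u x| < s / ‖u‖ * (δ / s * ‖u‖) := by gcongr; exact hlt x
      _ = δ := by field_simp
  have hray := hg.coordEnergy_smul_le hu hr.le
  rw [hnorm] at hsum
  rw [coordEnergy, hnorm] at hray
  linarith

theorem primitive_coord_le (hg : Nonlinearity g) {u : H} (hu : u ∈ nehariManifold T g) (x : ι) :
    ∫ t in (0 : ℝ)..T u x, g t ≤ 1 / 2 * ‖u‖ ^ 2 := by
  have hterm : (∫ t in (0 : ℝ)..T u x, g t) ≤ ∑' y, ∫ t in (0 : ℝ)..T u y, g t :=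
    (hg.vanishes_primitive.summable (T u)).le_tsum x fun y _ => hg.primitive_nonneg _
  have henergy := hg.excess_nonneg (T := T) u
  rw [← hg.coordEnergy_eq_excess hu, coordEnergy] at henergy
  linarith

theorem exists_norm_le_of_coordEnergy_le (hg : Nonlinearity g) (C : ℝ) :
    ∃ R, ∀ u ∈ nehariManifold T g, coordEnergy T g u ≤ C → ‖u‖ ≤ R := by
  obtain ⟨κ, hκ, hcoord⟩ := hg.exists_mul_norm_le_abs_coord (T := T) C
  obtain ⟨R, -, hR⟩ := (hasBasis_cobounded_norm (E := ℝ)).eventually_iff.mp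
    (hg.superquadratic.eventually_ge_atTop (1 / κ ^ 2))
  refine ⟨R / κ, fun u hu hC => ?_⟩
  obtain ⟨x, hx⟩ := hcoord u hu hC
  by_contra! hlt
  have hu0 : 0 < ‖u‖ := norm_pos_iff.mpr hu.1
  have hTsq : (κ * ‖u‖) ^ 2 ≤ T u x ^ 2 := by
    rw [← sq_abs (T u x)]
    gcongr
  have hsup := hR (((div_lt_iff₀' hκ).mp hlt).le.trans hx)
  rw [le_div_iff₀ ((by positivity : 0 < (κ * ‖u‖) ^ 2).trans_le hTsq)] at hsup
  have hlower : ‖u‖ ^ 2 ≤ ∫ t in (0 : ℝ)..T u x, g t :=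
    calc ‖u‖ ^ 2 = 1 / κ ^ 2 * (κ * ‖u‖) ^ 2 := by field_simp
      _ ≤ 1 / κ ^ 2 * T u x ^ 2 := by gcongr
      _ ≤ _ := hsup
  have hupper := hg.primitive_coord_le hu x
  have hpos : 0 < ‖u‖ ^ 2 := by positivity
  linarith

end Nonlinearity

end Variational

/-! ### Minimizers on the Nehari manifold are critical points -/

/-- Strict differentiability compares `J` at `t • (u + s • v)` and at `t • u`, two points that both
move to `u`, up to an error `o(s)`. -/
theorem eq_zero_of_frequently_le {E : Type*} [NormedAddCommGroup E] [NormedSpace ℝ E]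
    {J : E → ℝ} {L : E →L[ℝ] ℝ} {u : E} (hJ : HasStrictFDerivAt J L u)
    (hray : ∀ᶠ t : ℝ in 𝓝 1, J (t • u) ≤ J u)
    (hpert : ∀ v : E, ∃ᶠ p : ℝ × ℝ in 𝓝 (1, 0), 0 < p.2 ∧ J u ≤ J (p.1 • (u + p.2 • v))) :
    L = 0 := by
  suffices hnonneg : ∀ v, 0 ≤ L v by
    ext v
    exact le_antisymm (by simpa using hnonneg (-v)) (hnonneg v)
  intro v
  have hcurves : Tendsto (fun p : ℝ × ℝ => (p.1 • (u + p.2 • v), p.1 • u)) (𝓝 (1, 0))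
      (𝓝 (u, u)) := Continuous.tendsto' (by fun_prop) _ _ (by simp)
  have hdiff (p : ℝ × ℝ) : p.1 • (u + p.2 • v) - p.1 • u = (p.1 * p.2) • v := by
    rw [smul_add, add_sub_cancel_left, smul_smul]
  have hlo : (fun p : ℝ × ℝ => J (p.1 • (u + p.2 • v)) - J (p.1 • u) - p.1 * p.2 * L v)
      =o[𝓝 (1, 0)] fun p => p.1 * p.2 := by
    have h := hJ.isLittleO.comp_tendsto hcurves
    simp only [Function.comp_def, hdiff, map_smul, smul_eq_mul] at h
    exact h.trans_isBigO (isBigO_of_le' (c := ‖v‖) _ fun p => by rw [norm_smul, mul_comm])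
  refine le_of_forall_pos_le_add fun ε hε => ?_
  have hfst : Tendsto Prod.fst (𝓝 ((1 : ℝ), (0 : ℝ))) (𝓝 1) := continuous_fst.tendsto _
  obtain ⟨⟨t, s⟩, ⟨hs, hle⟩, hbound, ht, hmax⟩ := ((hpert v).and_eventually
    ((hlo.def hε).and ((hfst.eventually_const_lt zero_lt_one).and (hfst.eventually hray)))).exists
  have hts : 0 < t * s := mul_pos ht hs
  simp only [Real.norm_eq_abs, abs_of_pos hts] at hbound hle hmax
  have hprod : 0 ≤ t * s * (L v + ε) := by linarith [(abs_le.mp hbound).2]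
  exact nonneg_of_mul_nonneg_right hprod hts

namespace Nonlinearity

variable {ι : Type*} {H : Type*} [NormedAddCommGroup H] [InnerProductSpace ℝ H]
  {T : H ≃L[ℝ] ℓ²(ι, ℝ)} {g : ℝ → ℝ}

/-- The Nehari form changes sign along the ray through `u`, hence also along rays nearby. -/
theorem frequently_smul_mem_nehariManifold (hg : Nonlinearity g) {u : H}
    (hu : u ∈ nehariManifold T g) (v : H) :
    ∃ᶠ p : ℝ × ℝ in 𝓝 (1, 0), 0 < p.2 ∧ p.1 • (u + p.2 • v) ∈ nehariManifold T g := by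
  refine Metric.nhds_basis_ball.frequently_iff.mpr fun {r} hr => ?_
  obtain ⟨ε, hε0, hεr⟩ := exists_between (lt_min hr one_pos)
  rw [lt_min_iff] at hεr
  have hcont : Continuous fun p : ℝ × ℝ => nehariForm T g (p.1 • (u + p.2 • v)) :=
    hg.continuous_nehariForm.comp (by fun_prop)
  have hpos : ∀ᶠ s in 𝓝 (0 : ℝ), 0 < nehariForm T g ((1 - ε) • (u + s • v)) :=
    (hcont.comp (Continuous.prodMk_right (1 - ε))).continuousAt.eventually_const_lt
      (by simpa using hg.nehariForm_smul_pos hu (t := 1 - ε) (by linarith) (by linarith))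
  have hneg : ∀ᶠ s in 𝓝 (0 : ℝ), nehariForm T g ((1 + ε) • (u + s • v)) < 0 :=
    (hcont.comp (Continuous.prodMk_right (1 + ε))).continuousAt.eventually_lt_const
      (by simpa using hg.nehariForm_smul_neg hu (t := 1 + ε) (by linarith))
  have hne : ∀ᶠ s in 𝓝 (0 : ℝ), u + s • v ≠ 0 :=
    ContinuousAt.eventually_ne (by fun_prop) (by simpa using hu.1)
  obtain ⟨s, ⟨hsp, hsn, hsne⟩, hs0, hsr⟩ :=
    (((hpos.and (hneg.and hne)).filter_mono nhdsWithin_le_nhds).and (Ioo_mem_nhdsGT hr)).exists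
  obtain ⟨t, ht, hzero⟩ := intermediate_value_Icc' (by linarith : 1 - ε ≤ 1 + ε)
    (hcont.comp (Continuous.prodMk_left s)).continuousOn ⟨hsn.le, hsp.le⟩
  have ht0 : 0 < t := by linarith [ht.1]
  have htε : |t - 1| ≤ ε := abs_le.mpr ⟨by linarith [ht.1], by linarith [ht.2]⟩
  refine ⟨(t, s), ?_, hs0, smul_ne_zero ht0.ne' hsne, hzero⟩
  rw [Metric.mem_ball, Prod.dist_eq, max_lt_iff, Real.dist_eq, Real.dist_eq, sub_zero,
    abs_of_pos hs0]
  exact ⟨htε.trans_lt hεr.1, hsr⟩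

theorem hasFDerivAt_zero_of_isMinOn (hg : Nonlinearity g) {u : H}
    (hu : u ∈ nehariManifold T g) (hmin : IsMinOn (coordEnergy T g) (nehariManifold T g) u) :
    HasFDerivAt (coordEnergy T g) (0 : H →L[ℝ] ℝ) u := by
  have hstrict := hg.hasStrictFDerivAt_coordEnergy (T := T) u
  rw [← eq_zero_of_frequently_le hstrict]
  · exact hstrict.hasFDerivAt
  · filter_upwards [lt_mem_nhds zero_lt_one] with t ht using hg.coordEnergy_smul_le hu ht.le
  · exact fun v => (hg.frequently_smul_mem_nehariManifold hu v).mono fun p hp =>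
      ⟨hp.1, hmin hp.2⟩

end Nonlinearity

/-! ### Existence of a minimizer -/

section Minimizer

variable {ι : Type*} {H : Type*} [NormedAddCommGroup H] [InnerProductSpace ℝ H]

/-- Some norm-preserving maps of `H` permute the coordinates transitively; for a lattice these are
the translations. -/
def CoordTransitive (T : H ≃L[ℝ] ℓ²(ι, ℝ)) : Prop :=
  ∀ (x y : ι) (u : H), ∃ u' : H, ‖u'‖ = ‖u‖ ∧
    ∃ σ : Equiv.Perm ι, σ x = y ∧ ∀ z, T u' z = T u (σ z)

/-- The infimum of the energy over the Nehari manifold. -/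
def groundLevel (T : H ≃L[ℝ] ℓ²(ι, ℝ)) (g : ℝ → ℝ) : ℝ :=
  sInf (coordEnergy T g '' nehariManifold T g)

variable {T : H ≃L[ℝ] ℓ²(ι, ℝ)} {g : ℝ → ℝ}

theorem tsum_coord_perm (φ : ℝ → ℝ) {u u' : H} {σ : Equiv.Perm ι}
    (hσ : ∀ z, T u' z = T u (σ z)) : ∑' z, φ (T u' z) = ∑' z, φ (T u z) := by
  simp_rw [hσ]
  exact σ.tsum_eq fun z => φ (T u z)

theorem coordEnergy_perm {u u' : H} (hnorm : ‖u'‖ = ‖u‖) {σ : Equiv.Perm ι}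
    (hσ : ∀ z, T u' z = T u (σ z)) : coordEnergy T g u' = coordEnergy T g u := by
  rw [coordEnergy, coordEnergy, hnorm, tsum_coord_perm (fun t => ∫ s in (0 : ℝ)..t, g s) hσ]

theorem mem_nehariManifold_perm {u u' : H} (hnorm : ‖u'‖ = ‖u‖) {σ : Equiv.Perm ι}
    (hσ : ∀ z, T u' z = T u (σ z)) (hu : u ∈ nehariManifold T g) : u' ∈ nehariManifold T g := by
  refine ⟨norm_ne_zero_iff.mp (hnorm ▸ norm_ne_zero_iff.mpr hu.1), ?_⟩
  rw [nehariForm, hnorm, tsum_coord_perm (fun t => g t * t) hσ]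
  exact hu.2

namespace Nonlinearity

theorem bddBelow_coordEnergy (hg : Nonlinearity g) :
    BddBelow (coordEnergy T g '' nehariManifold T g) := by
  refine ⟨0, Set.forall_mem_image.mpr fun u hu => ?_⟩
  rw [hg.coordEnergy_eq_excess hu]
  exact hg.excess_nonneg u

theorem groundLevel_le_excess (hg : Nonlinearity g) {u : H} (hu : u ≠ 0)
    (hneg : nehariForm T g u ≤ 0) : groundLevel T g ≤ excess T g u := by
  obtain ⟨t, ht0, ht1, ht⟩ := hg.exists_smul_mem_nehariManifold hu hneg
  calc groundLevel T g ≤ coordEnergy T g (t • u) :=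
        csInf_le hg.bddBelow_coordEnergy (Set.mem_image_of_mem _ ht)
    _ = excess T g (t • u) := hg.coordEnergy_eq_excess ht
    _ ≤ excess T g u := hg.excess_smul_le u ht0.le ht1

theorem exists_minimizing_seq (hg : Nonlinearity g) (htrans : CoordTransitive T) (o : ι) :
    ∃ w : ℕ → H, (∀ n, w n ∈ nehariManifold T g) ∧ (∃ δ > 0, ∀ n, δ ≤ |T (w n) o|) ∧
      (∃ R, ∀ n, ‖w n‖ ≤ R) ∧ Tendsto (fun n => excess T g (w n)) atTop (𝓝 (groundLevel T g)) := by
  have : Nonempty ι := ⟨o⟩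
  obtain ⟨δ, hδ, hsmall⟩ := hg.exists_nehariForm_pos (T := T)
  have hcentre (u : H) (hu : u ∈ nehariManifold T g) : ∃ u' ∈ nehariManifold T g,
      coordEnergy T g u' = coordEnergy T g u ∧ δ ≤ |T u' o| := by
    obtain ⟨y, hy⟩ : ∃ y, δ ≤ |T u y| := by
      by_contra! h
      exact (hsmall u hu.1 h).ne' hu.2
    obtain ⟨u', hnorm, σ, rfl, hσ⟩ := htrans o y u
    exact ⟨u', mem_nehariManifold_perm hnorm hσ hu, coordEnergy_perm hnorm hσ, hσ o ▸ hy⟩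
  obtain ⟨e, hanti, hlim, he⟩ :=
    exists_seq_tendsto_sInf (hg.nehariManifold_nonempty.image _) (hg.bddBelow_coordEnergy (T := T))
  choose u hu hue using he
  choose w hw hwu hwo using fun n => hcentre (u n) (hu n)
  have hwe (n : ℕ) : coordEnergy T g (w n) = e n := (hwu n).trans (hue n)
  obtain ⟨R, hR⟩ := hg.exists_norm_le_of_coordEnergy_le (T := T) (e 0)
  refine ⟨w, hw, ⟨δ, hδ, hwo⟩, ⟨R, fun n => hR _ (hw n) ?_⟩, ?_⟩
  · exact (hwe n).trans_le (hanti (Nat.zero_le n))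
  · exact hlim.congr fun n => by rw [← hwe, hg.coordEnergy_eq_excess (hw n)]

variable {w : ℕ → H} {B : ℝ}

theorem tendsto_nehariForm_add_sub (hg : Nonlinearity g) (u : H) (hB : ∀ n, ‖T (w n)‖ ≤ B)
    (hw : ∀ x, Tendsto (fun n => T (w n) x) atTop (𝓝 0)) :
    Tendsto (fun n => nehariForm T g (u + w n) - nehariForm T g (w n)) atTop
      (𝓝 (nehariForm T g u)) := by
  have hsum := hg.vanishes_mul.tendsto_tsum_add_sub (T u) hB hw
  have hcross : Tendsto (fun n => inner ℝ u (w n)) atTop (𝓝 0) := by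
    simpa using lp_tendsto_dual_zero hB hw ((innerSL ℝ u).comp (T.symm : ℓ²(ι, ℝ) →L[ℝ] H))
  have hlim := ((hcross.const_mul 2).const_add (‖u‖ ^ 2)).sub hsum
  simp only [mul_zero, add_zero] at hlim
  refine hlim.congr fun n => ?_
  simp only [nehariForm, map_add, norm_add_sq_real]
  ring

theorem tendsto_excess_add_sub (hg : Nonlinearity g) (u : H) (hB : ∀ n, ‖T (w n)‖ ≤ B)
    (hw : ∀ x, Tendsto (fun n => T (w n) x) atTop (𝓝 0)) :
    Tendsto (fun n => excess T g (u + w n) - excess T g (w n)) atTop (𝓝 (excess T g u)) := by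
  simpa only [excess, map_add] using
    hg.vanishes_excessDensity.tendsto_tsum_add_sub (T u) hB hw

/-- If the Nehari form of the limit `u` were positive, then that of the remainder `w n` would
become negative, and the remainder alone would cost at least the ground level. -/
theorem limit_of_minimizing_seq (hg : Nonlinearity g) {u : H} (hu : u ≠ 0)
    (hmem : ∀ n, u + w n ∈ nehariManifold T g) (hB : ∀ n, ‖T (w n)‖ ≤ B)
    (hw : ∀ x, Tendsto (fun n => T (w n) x) atTop (𝓝 0))
    (hlim : Tendsto (fun n => excess T g (u + w n)) atTop (𝓝 (groundLevel T g))) :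
    nehariForm T g u ≤ 0 ∧ excess T g u ≤ groundLevel T g := by
  have hform : Tendsto (fun n => nehariForm T g (w n)) atTop (𝓝 (-nehariForm T g u)) := by
    simpa [(hmem _).2] using (hg.tendsto_nehariForm_add_sub u hB hw).neg
  have hexcess : Tendsto (fun n => excess T g (w n)) atTop
      (𝓝 (groundLevel T g - excess T g u)) := by
    simpa using hlim.sub (hg.tendsto_excess_add_sub u hB hw)
  refine ⟨?_, sub_nonneg.mp (ge_of_tendsto' hexcess fun n => hg.excess_nonneg _)⟩
  by_contra! hpos
  have hlow : ∀ᶠ n in atTop, groundLevel T g ≤ excess T g (w n) := by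
    filter_upwards [hform.eventually_lt_const (neg_neg_of_pos hpos)] with n hn
    refine hg.groundLevel_le_excess (fun h0 => hn.ne ?_) hn.le
    simp [h0, nehariForm]
  linarith [ge_of_tendsto hexcess hlow, hg.excess_pos (T := T) hu]

theorem exists_isMinOn_nehariManifold (hg : Nonlinearity g) [Countable ι] [Nonempty ι]
    (htrans : CoordTransitive T) :
    ∃ u ∈ nehariManifold T g, IsMinOn (coordEnergy T g) (nehariManifold T g) u := by
  obtain ⟨o⟩ := ‹Nonempty ι›
  obtain ⟨w, hmem, ⟨δ, hδ, hwo⟩, ⟨R, hR⟩, hlim⟩ := hg.exists_minimizing_seq htrans o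
  have hB (n : ℕ) : ‖T (w n)‖ ≤ ‖(T : H →L[ℝ] ℓ²(ι, ℝ))‖ * R :=
    (T : H →L[ℝ] ℓ²(ι, ℝ)).le_opNorm_of_le (hR n)
  obtain ⟨v, k, hk, hv⟩ := exists_subseq_tendsto_apply hB
  obtain ⟨u, rfl⟩ := T.surjective v
  have hu : u ≠ 0 := by
    rintro rfl
    exact hδ.not_ge (by simpa using ge_of_tendsto' (hv o).abs fun n => hwo (k n))
  have hrem (n : ℕ) : ‖T (w (k n) - u)‖ ≤ ‖(T : H →L[ℝ] ℓ²(ι, ℝ))‖ * R + ‖T u‖ := by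
    rw [map_sub]
    exact (norm_sub_le _ _).trans (by gcongr; exact hB _)
  have hzero (x : ι) : Tendsto (fun n => T (w (k n) - u) x) atTop (𝓝 0) := by
    simpa using (hv x).sub_const (T u x)
  obtain ⟨hform, hexcess⟩ := hg.limit_of_minimizing_seq hu (w := fun n => w (k n) - u)
    (by simpa using fun n => hmem (k n)) hrem hzero
    (by simpa [Function.comp_def] using hlim.comp hk.tendsto_atTop)
  obtain ⟨t, ht0, ht1, ht⟩ := hg.exists_smul_mem_nehariManifold hu hform
  refine ⟨t • u, ht, fun z hz => ?_⟩
  calc coordEnergy T g (t • u) = excess T g (t • u) := hg.coordEnergy_eq_excess ht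
    _ ≤ excess T g u := hg.excess_smul_le u ht0.le ht1
    _ ≤ groundLevel T g := hexcess
    _ ≤ coordEnergy T g z := csInf_le hg.bddBelow_coordEnergy (Set.mem_image_of_mem _ hz)

theorem exists_groundState (hg : Nonlinearity g) [Countable ι] [Nonempty ι]
    (htrans : CoordTransitive T) :
    ∃ u : H, u ≠ 0 ∧ HasFDerivAt (coordEnergy T g) (0 : H →L[ℝ] ℝ) u ∧
      IsGLB (coordEnergy T g '' {u | u ≠ 0 ∧ fderiv ℝ (coordEnergy T g) u u = 0})
        (coordEnergy T g u) ∧ 0 < coordEnergy T g u := by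
  obtain ⟨u, hu, hmin⟩ := hg.exists_isMinOn_nehariManifold htrans
  refine ⟨u, hu.1, hg.hasFDerivAt_zero_of_isMinOn hu hmin, ?_, ?_⟩
  · rw [← hg.nehariManifold_eq]
    exact IsLeast.isGLB ⟨Set.mem_image_of_mem _ hu, Set.forall_mem_image.mpr hmin⟩
  · rw [hg.coordEnergy_eq_excess hu]
    exact hg.excess_pos hu.1

end Nonlinearity

end Minimizer

/-! ### Parseval's identity and translations -/

section Fourier

variable {d : ℕ}

theorem integral_norm_sq (p : Lp ℂ 2 (cubeMeasure d)) :
    ∫ θ, ‖p θ‖ ^ 2 ∂cubeMeasure d = ‖p‖ ^ 2 := by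
  have h : inner ℂ p p = ((∫ θ, ‖p θ‖ ^ 2 ∂cubeMeasure d : ℝ) : ℂ) := by
    simp_rw [L2.inner_def, inner_self_eq_norm_sq_to_K, ← integral_complex_ofReal,
      Complex.ofReal_pow, Complex.coe_algebraMap]
  rw [← inner_self_eq_norm_sq (𝕜 := ℂ) p, h, RCLike.re_to_complex, Complex.ofReal_re]

theorem inner_characterLp_fourierTransform (x : Fin d → ℤ) (u : EllTwo d) :
    inner ℂ (characterLp x) (fourierTransform u) = ((2 * Real.pi) ^ d : ℝ) * (u x : ℂ) := by
  have h := (hasSum_fourierTransform u).mapL (innerSL ℂ (characterLp x))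
  simp only [innerSL_apply_apply, inner_smul_right, inner_characterLp] at h
  rw [← h.tsum_eq, tsum_eq_single x fun y hy => by simp [hy.symm], if_pos rfl, mul_comm]

theorem norm_fourierTransform_sq (u : EllTwo d) :
    ‖fourierTransform u‖ ^ 2 = (2 * Real.pi) ^ d * ‖u‖ ^ 2 := by
  have hterm (x : Fin d → ℤ) : inner ℂ (fourierTransform u) ((u x : ℂ) • characterLp x)
      = (((2 * Real.pi) ^ d * u x ^ 2 : ℝ) : ℂ) := by
    rw [inner_smul_right, ← inner_conj_symm, inner_characterLp_fourierTransform, map_mul,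
      Complex.conj_ofReal, Complex.conj_ofReal]
    push_cast
    ring
  have h := (hasSum_fourierTransform u).mapL (innerSL ℂ (fourierTransform u))
  simp only [innerSL_apply_apply, hterm] at h
  have h' := Complex.hasSum_ofReal.mpr ((lp_hasSum_sq u).mul_left ((2 * Real.pi) ^ d))
  rw [← inner_self_eq_norm_sq (𝕜 := ℂ), h.unique h', RCLike.re_to_complex, Complex.ofReal_re]

theorem character_add (x y : Fin d → ℤ) (θ : Fin d → ℝ) :
    character (x + y) θ = character x θ * character y θ := by
  simp only [character, ← Complex.exp_add, ← mul_add, ← Finset.sum_add_distrib, Pi.add_apply,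
    Int.cast_add, add_mul]

theorem memLp_top_character (x : Fin d → ℤ) : MemLp (character x) ∞ (cubeMeasure d) :=
  memLp_top_of_bound (continuous_character x).aestronglyMeasurable 1
    (Eventually.of_forall fun θ => (norm_character x θ).le)

/-- Multiplication by `θ ↦ e^{i z·θ}` on `L²([-π, π]ᵈ; ℂ)`, the Fourier transform of a
translation. -/
def modulation (z : Fin d → ℤ) : Lp ℂ 2 (cubeMeasure d) →L[ℂ] Lp ℂ 2 (cubeMeasure d) :=
  (ContinuousLinearMap.mul ℂ ℂ).holderL (cubeMeasure d) ∞ 2 2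
    ((memLp_top_character z).toLp (character z))

theorem coeFn_modulation (z : Fin d → ℤ) (p : Lp ℂ 2 (cubeMeasure d)) :
    modulation z p =ᵐ[cubeMeasure d] fun θ => character z θ * p θ := by
  filter_upwards [(ContinuousLinearMap.mul ℂ ℂ).coeFn_holder (r := 2)
    ((memLp_top_character z).toLp (character z)) p, (memLp_top_character z).coeFn_toLp]
    with θ hθ hz
  rw [← hz]
  exact hθ

theorem norm_modulation_apply (z : Fin d → ℤ) (p : Lp ℂ 2 (cubeMeasure d)) :
    ∀ᵐ θ ∂cubeMeasure d, ‖modulation z p θ‖ = ‖p θ‖ := by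
  filter_upwards [coeFn_modulation z p] with θ hθ
  rw [hθ, norm_mul, norm_character, one_mul]

theorem modulation_characterLp (z x : Fin d → ℤ) :
    modulation z (characterLp x) = characterLp (x + z) := by
  refine Lp.ext ?_
  filter_upwards [coeFn_modulation z (characterLp x), (memLp_character x).coeFn_toLp,
    (memLp_character (x + z)).coeFn_toLp] with θ hθ hx hxz
  rw [hθ, characterLp, characterLp, hx, hxz, character_add, mul_comm]

/-- The translate `x ↦ u (x + z)` of a sequence `u`. -/
def shift (z : Fin d → ℤ) (u : EllTwo d) : EllTwo d :=
  ⟨fun x => u (x + z), memℓp_gen <| by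
    simpa [Function.comp_def] using
      (summable_sq u).comp_injective (Equiv.addRight z).injective⟩

@[simp] theorem shift_apply (z : Fin d → ℤ) (u : EllTwo d) (x : Fin d → ℤ) :
    shift z u x = u (x + z) := rfl

theorem modulation_fourierTransform_shift (z : Fin d → ℤ) (u : EllTwo d) :
    modulation z (fourierTransform (shift z u)) = fourierTransform u := by
  have h := (hasSum_fourierTransform (shift z u)).mapL (modulation z)
  simp only [map_smul, modulation_characterLp, shift_apply] at h
  have h' := (Equiv.addRight z).hasSum_iff.mpr (hasSum_fourierTransform u)
  simp only [Function.comp_def, Equiv.coe_addRight] at h'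
  exact h.unique h'

theorem norm_fourierTransform_shift_apply (z : Fin d → ℤ) (u : EllTwo d) :
    ∀ᵐ θ ∂cubeMeasure d, ‖fourierTransform (shift z u) θ‖ = ‖fourierTransform u θ‖ := by
  rw [← modulation_fourierTransform_shift z u]
  filter_upwards [norm_modulation_apply z (fourierTransform (shift z u))] with θ hθ
  exact hθ.symm

theorem fourierTransform_single (x : Fin d → ℤ) :
    fourierTransform (lp.single 2 x (1 : ℝ)) = characterLp x := by
  rw [fourierTransform, tsum_eq_single x fun y hy => by simp [hy]]
  simp

end Fourier

/-! ### The fractional Laplacian of a real sequence is real -/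

section FracLaplacian

variable {d : ℕ} {α : ℝ}

theorem symbol_rpow_nonneg (α : ℝ) (θ : Fin d → ℝ) : 0 ≤ symbol θ ^ α :=
  Real.rpow_nonneg (symbol_nonneg θ) α

theorem symbol_rpow_le (hα : 0 ≤ α) (θ : Fin d → ℝ) : symbol θ ^ α ≤ (4 * d : ℝ) ^ α := by
  refine Real.rpow_le_rpow (symbol_nonneg θ) ?_ hα
  calc symbol θ ≤ ∑ _i : Fin d, (4 : ℝ) :=
        Finset.sum_le_sum fun i _ => by linarith [Real.sin_sq_le_one (θ i / 2)]
    _ = 4 * d := by simp [mul_comm]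

theorem symbol_neg (θ : Fin d → ℝ) : symbol (-θ) = symbol θ := by
  simp [symbol, neg_div]

theorem conj_character (x : Fin d → ℤ) (θ : Fin d → ℝ) :
    starRingEnd ℂ (character x θ) = Complex.exp (-(Complex.I * ∑ i, (x i : ℂ) * (θ i : ℂ))) := by
  rw [character, ← Complex.exp_conj]
  simp

theorem character_neg (x : Fin d → ℤ) (θ : Fin d → ℝ) :
    character x (-θ) = starRingEnd ℂ (character x θ) := by
  rw [conj_character, character]
  simp

theorem measurePreserving_neg_cubeMeasure :
    MeasurePreserving (Neg.neg : (Fin d → ℝ) → Fin d → ℝ) (cubeMeasure d) (cubeMeasure d) := by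
  have hcube : Neg.neg ⁻¹' (Set.univ.pi fun _ : Fin d => Set.Icc (-Real.pi) Real.pi)
      = Set.univ.pi fun _ : Fin d => Set.Icc (-Real.pi) Real.pi := by
    ext θ
    simp only [Set.mem_preimage, Set.mem_univ_pi, Set.mem_Icc, Pi.neg_apply, neg_le_neg_iff,
      neg_le (b := θ _), and_comm]
  have h := (Measure.measurePreserving_neg (volume : Measure (Fin d → ℝ))).restrict_preimage
    (MeasurableSet.univ_pi fun _ : Fin d => measurableSet_Icc (a := -Real.pi) (b := Real.pi))
  rwa [hcube] at h

theorem conj_integral_of_apply_neg {F : (Fin d → ℝ) → ℂ}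
    (hF : ∀ θ, F (-θ) = starRingEnd ℂ (F θ)) :
    starRingEnd ℂ (∫ θ, F θ ∂cubeMeasure d) = ∫ θ, F θ ∂cubeMeasure d := by
  rw [← integral_conj, ← measurePreserving_neg_cubeMeasure.integral_comp
    (MeasurableEquiv.neg (Fin d → ℝ)).measurableEmbedding F]
  simp_rw [hF]

/-- The matrix of `(-Δ)^α` in the standard basis of `ℓ²(ℤᵈ)`. -/
def fracLaplacianKernel (α : ℝ) (x y : Fin d → ℤ) : ℂ :=
  (((2 * Real.pi) ^ d)⁻¹ : ℝ) * ∫ θ, ((symbol θ ^ α : ℝ) : ℂ) * character y θ *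
    starRingEnd ℂ (character x θ) ∂cubeMeasure d

theorem conj_fracLaplacianKernel (α : ℝ) (x y : Fin d → ℤ) :
    starRingEnd ℂ (fracLaplacianKernel α x y) = fracLaplacianKernel α x y := by
  rw [fracLaplacianKernel, map_mul, Complex.conj_ofReal,
    conj_integral_of_apply_neg fun θ => by simp [symbol_neg, character_neg]]

theorem fracLaplacian_eq (α : ℝ) (u : EllTwo d) (x : Fin d → ℤ) :
    fracLaplacian α u x = (((2 * Real.pi) ^ d)⁻¹ : ℝ) *
      ∫ θ, ((symbol θ ^ α : ℝ) : ℂ) * fourierTransform u θ * starRingEnd ℂ (character x θ)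
        ∂cubeMeasure d := by
  simp only [fracLaplacian, inverseFourierTransform, conj_character]

theorem memLp_symbol_rpow_mul_character (hα : 0 ≤ α) (x : Fin d → ℤ) :
    MemLp (fun θ => ((symbol θ ^ α : ℝ) : ℂ) * character x θ) 2 (cubeMeasure d) := by
  refine MemLp.of_bound ((Complex.measurable_ofReal.comp
    (measurable_symbol_rpow α)).aestronglyMeasurable.mul
      (continuous_character x).aestronglyMeasurable) ((4 * d : ℝ) ^ α)
    (Eventually.of_forall fun θ => ?_)
  rw [norm_mul, norm_character, mul_one, Complex.norm_real,
    Real.norm_of_nonneg (symbol_rpow_nonneg α θ)]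
  exact symbol_rpow_le hα θ

theorem hasSum_fracLaplacian (hα : 0 ≤ α) (u : EllTwo d) (x : Fin d → ℤ) :
    HasSum (fun y => (u y : ℂ) * fracLaplacianKernel α x y) (fracLaplacian α u x) := by
  let k : Lp ℂ 2 (cubeMeasure d) := (memLp_symbol_rpow_mul_character hα x).toLp _
  have hk (p : Lp ℂ 2 (cubeMeasure d)) : inner ℂ k p =
      ∫ θ, ((symbol θ ^ α : ℝ) : ℂ) * p θ * starRingEnd ℂ (character x θ) ∂cubeMeasure d := by
    rw [L2.inner_def]
    refine integral_congr_ae ?_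
    filter_upwards [(memLp_symbol_rpow_mul_character hα x).coeFn_toLp] with θ hθ
    rw [hθ, RCLike.inner_apply, map_mul, Complex.conj_ofReal]
    ring
  have hchar (y : Fin d → ℤ) : fracLaplacianKernel α x y =
      (((2 * Real.pi) ^ d)⁻¹ : ℝ) * inner ℂ k (characterLp y) := by
    rw [hk, fracLaplacianKernel]
    congr 1
    refine integral_congr_ae ?_
    filter_upwards [(memLp_character y).coeFn_toLp] with θ hθ
    rw [characterLp, hθ]
  have h := ((hasSum_fourierTransform u).mapL (innerSL ℂ k)).mul_left
    ((((2 * Real.pi) ^ d)⁻¹ : ℝ) : ℂ)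
  simp only [innerSL_apply_apply, inner_smul_right, mul_left_comm _ (Complex.ofReal (u _)),
    ← hchar] at h
  rwa [fracLaplacian_eq, ← hk]

theorem ofReal_re_fracLaplacian (hα : 0 ≤ α) (u : EllTwo d) (x : Fin d → ℤ) :
    ((fracLaplacian α u x).re : ℂ) = fracLaplacian α u x := by
  rw [← Complex.conj_eq_iff_re]
  have h := (hasSum_fracLaplacian hα u x).map (starRingEnd ℂ) Complex.continuous_conj
  simp only [Function.comp_def, map_mul, Complex.conj_ofReal, conj_fracLaplacianKernel] at h
  exact h.unique (hasSum_fracLaplacian hα u x)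

end FracLaplacian

/-! ### `H^α` as an isomorphic copy of `ℓ²(ℤᵈ)` -/

section Isomorphism

variable {d : ℕ} {α : ℝ} {h : (Fin d → ℤ) → ℝ}

theorem integrable_norm_sq (p : Lp ℂ 2 (cubeMeasure d)) :
    Integrable (fun θ => ‖p θ‖ ^ 2) (cubeMeasure d) :=
  (Lp.memLp p).integrable_norm_pow two_ne_zero

theorem integrable_symbol_rpow_mul_norm_sq (hα : 0 ≤ α) (p : Lp ℂ 2 (cubeMeasure d)) :
    Integrable (fun θ => symbol θ ^ α * ‖p θ‖ ^ 2) (cubeMeasure d) := by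
  refine (integrable_norm_sq p).bdd_mul (c := (4 * d : ℝ) ^ α)
    (measurable_symbol_rpow α).aestronglyMeasurable (Eventually.of_forall fun θ => ?_)
  rw [Real.norm_of_nonneg (symbol_rpow_nonneg α θ)]
  exact symbol_rpow_le hα θ

theorem integral_symbol_rpow_mul_norm_sq_le (hα : 0 ≤ α) (p : Lp ℂ 2 (cubeMeasure d)) :
    ∫ θ, symbol θ ^ α * ‖p θ‖ ^ 2 ∂cubeMeasure d ≤ (4 * d : ℝ) ^ α * ‖p‖ ^ 2 := by
  rw [← integral_norm_sq, ← integral_const_mul]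
  exact integral_mono (integrable_symbol_rpow_mul_norm_sq hα p)
    ((integrable_norm_sq p).const_mul _) fun θ =>
      mul_le_mul_of_nonneg_right (symbol_rpow_le hα θ) (sq_nonneg _)

theorem mem_hSubmodule (hα : 0 ≤ α) (hh : BoundedPositive h) (u : EllTwo d) :
    u ∈ hSubmodule α h := by
  refine ⟨integrable_symbol_rpow_mul_norm_sq hα _, ?_⟩
  obtain ⟨c₁, c₂, hc₁, -, hc⟩ := hh
  exact ((summable_sq u).mul_left c₂).of_nonneg_of_le
    (fun x => mul_nonneg (hc₁.le.trans (hc x).1) (sq_nonneg _))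
    (fun x => mul_le_mul_of_nonneg_right (hc x).2 (sq_nonneg _))

namespace HSpace

variable {hh : BoundedPositive h}

theorem toEllTwo_bijective (hα : 0 ≤ α) (hh : BoundedPositive h) :
    Function.Bijective (toEllTwo : HSpace α hh →ₗ[ℝ] EllTwo d) :=
  ⟨Subtype.val_injective, fun u => ⟨⟨u, mem_hSubmodule hα hh u⟩, rfl⟩⟩

theorem mul_norm_toEllTwo_sq_le {c : ℝ} (hc : ∀ x, c ≤ h x) (u : HSpace α hh) :
    c * ‖toEllTwo u‖ ^ 2 ≤ ‖u‖ ^ 2 := by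
  have hpot : c * ‖toEllTwo u‖ ^ 2 ≤ ∑' x, h x * u x ^ 2 :=
    hasSum_le (fun x => mul_le_mul_of_nonneg_right (hc x) (sq_nonneg _))
      ((lp_hasSum_sq (toEllTwo u)).mul_left c) u.summable_mul_sq.hasSum
  have hkin : 0 ≤ ((2 * Real.pi) ^ d)⁻¹ *
      ∫ θ, symbol θ ^ α * ‖fourierTransform (toEllTwo u) θ‖ ^ 2 ∂cubeMeasure d :=
    mul_nonneg (by positivity) (integral_nonneg fun θ =>
      mul_nonneg (symbol_rpow_nonneg α θ) (sq_nonneg _))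
  rw [norm_sq_eq]
  linarith

theorem norm_sq_le (hα : 0 ≤ α) {c : ℝ} (hc : ∀ x, h x ≤ c) (u : HSpace α hh) :
    ‖u‖ ^ 2 ≤ ((4 * d : ℝ) ^ α + c) * ‖toEllTwo u‖ ^ 2 := by
  have hpot : ∑' x, h x * u x ^ 2 ≤ c * ‖toEllTwo u‖ ^ 2 :=
    hasSum_le (fun x => mul_le_mul_of_nonneg_right (hc x) (sq_nonneg _))
      u.summable_mul_sq.hasSum ((lp_hasSum_sq (toEllTwo u)).mul_left c)
  have hkin : ((2 * Real.pi) ^ d)⁻¹ *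
      ∫ θ, symbol θ ^ α * ‖fourierTransform (toEllTwo u) θ‖ ^ 2 ∂cubeMeasure d
        ≤ (4 * d : ℝ) ^ α * ‖toEllTwo u‖ ^ 2 := by
    rw [inv_mul_le_iff₀ (by positivity), mul_left_comm, ← norm_fourierTransform_sq]
    exact integral_symbol_rpow_mul_norm_sq_le hα _
  rw [norm_sq_eq]
  linarith

theorem exists_norm_toEllTwo_le (hh : BoundedPositive h) :
    ∃ C : ℝ, ∀ u : HSpace α hh, ‖toEllTwo u‖ ≤ C * ‖u‖ := by
  obtain ⟨c, _, hc, -, hle⟩ := id hh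
  refine ⟨Real.sqrt c⁻¹, fun u => ?_⟩
  rw [← sq_le_sq₀ (norm_nonneg _) (by positivity), mul_pow, Real.sq_sqrt (by positivity),
    le_inv_mul_iff₀ hc]
  exact mul_norm_toEllTwo_sq_le (fun x => (hle x).1) u

theorem exists_norm_le (hα : 0 ≤ α) (hh : BoundedPositive h) :
    ∃ C : ℝ, ∀ u : HSpace α hh, ‖u‖ ≤ C * ‖toEllTwo u‖ := by
  obtain ⟨_, c, -, hc, hle⟩ := id hh
  refine ⟨Real.sqrt ((4 * d : ℝ) ^ α + c), fun u => ?_⟩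
  rw [← sq_le_sq₀ (norm_nonneg _) (by positivity), mul_pow, Real.sq_sqrt (by positivity)]
  exact norm_sq_le hα (fun x => (hle x).2) u

/-- The inclusion of `H^α` in `ℓ²(ℤᵈ)` as an isomorphism of topological vector spaces, for
`α ≥ 0`. -/
def equivEllTwo (hα : 0 ≤ α) (hh : BoundedPositive h) : HSpace α hh ≃L[ℝ] EllTwo d :=
  (LinearEquiv.ofBijective toEllTwo (toEllTwo_bijective hα hh)).toContinuousLinearEquivOfBounds
    (exists_norm_toEllTwo_le hh).choose (exists_norm_le hα hh).choose
    (exists_norm_toEllTwo_le hh).choose_spec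
    ((LinearEquiv.ofBijective _ _).surjective.forall.mpr fun u => by
      rw [LinearEquiv.symm_apply_apply]
      exact (exists_norm_le hα hh).choose_spec u)

@[simp] theorem equivEllTwo_apply (hα : 0 ≤ α) (hh : BoundedPositive h) (u : HSpace α hh) :
    equivEllTwo hα hh u = toEllTwo u := rfl

theorem norm_eq_of_toEllTwo_eq_shift (hper : ∀ x, h x = h 0) {z : Fin d → ℤ} {u u' : HSpace α hh}
    (hu' : toEllTwo u' = shift z (toEllTwo u)) : ‖u'‖ = ‖u‖ := by
  rw [← sq_eq_sq₀ (norm_nonneg _) (norm_nonneg _), norm_sq_eq, norm_sq_eq, hu',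
    ← (Equiv.addRight z).tsum_eq fun x => h x * u x ^ 2]
  congr 2
  · refine integral_congr_ae ?_
    filter_upwards [norm_fourierTransform_shift_apply z (toEllTwo u)] with θ hθ
    rw [hθ]
  · funext x
    rw [Equiv.coe_addRight, shift_apply, hper x, hper (x + z)]

theorem coordTransitive_equivEllTwo (hα : 0 ≤ α) (hh : BoundedPositive h)
    (hper : ∀ x, h x = h 0) : CoordTransitive (equivEllTwo hα hh) := by
  intro x y u
  obtain ⟨u', hu'⟩ := (toEllTwo_bijective hα hh).2 (shift (y - x) (toEllTwo u))
  refine ⟨u', norm_eq_of_toEllTwo_eq_shift hper hu', Equiv.addRight (y - x), ?_, fun z => ?_⟩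
  · simp
  · simp [hu']

theorem inner_eq_of_toEllTwo_eq_single (u : HSpace α hh) {v : HSpace α hh} {x : Fin d → ℤ}
    (hv : toEllTwo v = lp.single 2 x (1 : ℝ)) :
    inner ℝ u v = (fracLaplacian α (toEllTwo u) x).re + h x * u x := by
  change form u v = _
  rw [form, hv, fourierTransform_single, fracLaplacian_eq, Complex.re_ofReal_mul]
  congr 2
  · congr 1
    refine integral_congr_ae ?_
    filter_upwards [(memLp_character x).coeFn_toLp] with θ hθ
    rw [characterLp, hθ]
  · rw [tsum_eq_single x fun y hy => by simp [hy]]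
    simp

end HSpace

theorem isSolution_of_hasFDerivAt_zero (hα : 0 ≤ α) {hh : BoundedPositive h} {g : ℝ → ℝ}
    (hg : Nonlinearity g) {u : HSpace α hh}
    (hu : HasFDerivAt (coordEnergy (HSpace.equivEllTwo hα hh) g) (0 : HSpace α hh →L[ℝ] ℝ) u) :
    IsSolution α h (fun _ => g) (HSpace.toEllTwo u) := by
  intro x
  obtain ⟨v, hv⟩ := (HSpace.toEllTwo_bijective hα hh).2 (lp.single 2 x (1 : ℝ))
  have hderiv := DFunLike.congr_fun ((hg.hasStrictFDerivAt_coordEnergy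
    (T := HSpace.equivEllTwo hα hh) u).hasFDerivAt.unique hu) v
  have hreal : (fracLaplacian α (HSpace.toEllTwo u) x).re + h x * u x = g (u x) := by
    simpa [sub_eq_zero, HSpace.inner_eq_of_toEllTwo_eq_single u hv, hv,
      lp.inner_single_right] using hderiv
  rw [← ofReal_re_fracLaplacian hα (HSpace.toEllTwo u) x]
  exact_mod_cast hreal

end Isomorphism

/-! ### Lattice-periodic nonlinearities -/

theorem apply_eq_apply_zero_of_periodic {ι β : Type*} [Finite ι] [DecidableEq ι] {F : (ι → ℤ) → β}
    (hF : ∀ i, Function.Periodic F (Pi.single i 1)) (x : ι → ℤ) : F x = F 0 := by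
  have := Fintype.ofFinite ι
  have hsum (s : Finset ι) : Function.Periodic F (∑ i ∈ s, Pi.single i (x i)) := by
    induction s using Finset.induction_on with
    | empty => exact Function.periodic_with_period_zero F
    | insert i s hi ih =>
      rw [Finset.sum_insert hi]
      refine Function.Periodic.add_period ?_ ih
      simpa [← Pi.single_smul] using (hF i).zsmul (x i)
  simpa [Finset.univ_sum_single] using (hsum Finset.univ).eq

end FracSchrodinger

end

theorem theorem1p1_general {d : ℕ} {α : ℝ} (hα : 0 ≤ α)
    (h : (Fin d → ℤ) → ℝ) (f : (Fin d → ℤ) → ℝ → ℝ)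
    (hh : FracSchrodinger.BoundedPositive h)
    (hf₁ : ∀ x, Continuous (f x))
    (hf₃ : ∀ ε : ℝ, 0 < ε → ∃ δ : ℝ, 0 < δ ∧ ∀ x u, |u| < δ → |f x u| ≤ ε * |u|)
    (hf₄ : ∀ x, StrictMonoOn (fun u => f x u / |u|) (Set.Iio 0) ∧
      StrictMonoOn (fun u => f x u / |u|) (Set.Ioi 0))
    (hf₅ : ∀ M : ℝ, ∃ R : ℝ, 0 < R ∧
      ∀ x u, R ≤ |u| → M ≤ FracSchrodinger.primitive f x u / u ^ 2)
    (hf₆ : ∀ (x : Fin d → ℤ) (i : Fin d),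
      h (x + Pi.single i 1) = h x ∧ ∀ u, f (x + Pi.single i 1) u = f x u) :
    ∃ u : FracSchrodinger.HSpace α hh,
      FracSchrodinger.IsGroundState f u ∧ FracSchrodinger.IsSolution α h f u.toEllTwo := by
  have hh₀ : ∀ x, h x = h 0 :=
    FracSchrodinger.apply_eq_apply_zero_of_periodic fun i x => (hf₆ x i).1
  obtain ⟨g, rfl⟩ : ∃ g : ℝ → ℝ, f = fun _ => g :=
    ⟨f 0, funext <| FracSchrodinger.apply_eq_apply_zero_of_periodic fun i x =>
      funext (hf₆ x i).2⟩
  have hg : FracSchrodinger.Nonlinearity g :=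
    .of_forall_exists (hf₁ 0) (fun ε hε => (hf₃ ε hε).imp fun _ hδ => ⟨hδ.1, hδ.2 0⟩)
      (hf₄ 0).1 (hf₄ 0).2 fun M => (hf₅ M).imp fun _ hR => hR.2 0
  obtain ⟨u, hu, hcrit, hglb, hpos⟩ :=
    hg.exists_groundState (FracSchrodinger.HSpace.coordTransitive_equivEllTwo hα hh hh₀)
  exact ⟨u, ⟨hu, hcrit, hglb, hpos⟩, FracSchrodinger.isSolution_of_hasFDerivAt_zero hα hg hcrit⟩

theorem theorem1p1 {d : ℕ} (hd : 1 ≤ d) {α : ℝ} (hα₀ : 0 < α) (hα₁ : α < 1)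
    (h : (Fin d → ℤ) → ℝ) (f : (Fin d → ℤ) → ℝ → ℝ)
    (hh : FracSchrodinger.BoundedPositive h)
    (hf₁ : ∀ x, Continuous (f x))
    (hf₂ : ∃ a p : ℝ, 0 < a ∧ 2 < p ∧ ∀ x u, |f x u| ≤ a * (1 + |u| ^ (p - 1)))
    (hf₃ : ∀ ε : ℝ, 0 < ε → ∃ δ : ℝ, 0 < δ ∧ ∀ x u, |u| < δ → |f x u| ≤ ε * |u|)
    (hf₄ : ∀ x, StrictMonoOn (fun u => f x u / |u|) (Set.Iio 0) ∧
      StrictMonoOn (fun u => f x u / |u|) (Set.Ioi 0))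
    (hf₅ : ∀ M : ℝ, ∃ R : ℝ, 0 < R ∧
      ∀ x u, R ≤ |u| → M ≤ FracSchrodinger.primitive f x u / u ^ 2)
    (hf₆ : ∀ (x : Fin d → ℤ) (i : Fin d),
      h (x + Pi.single i 1) = h x ∧ ∀ u, f (x + Pi.single i 1) u = f x u) :
    ∃ u : FracSchrodinger.HSpace α hh,
      FracSchrodinger.IsGroundState f u ∧ FracSchrodinger.IsSolution α h f u.toEllTwo :=
  theorem1p1_general hα₀.le h f hh hf₁ hf₃ hf₄ hf₅ hf₆
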